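/- Let $A\in C^\infty(\mathbb R^2;\mathbb R)$, $b=\partial A/\partial x$ and $b_0=\min_{\mathbb R^2}|b|$. Assume that $b_0>0$, that $\{|b|=b_0\}=\{(0,0)\}$, that $\operatorname{Hess} b(0,0)>0$, and that $A(0,0)=0$, $\frac{\partial A}{\partial y}(0,0)=0$. Then $\phi(x,y)=(A(x,y),y)$ is a diffeomorphism of $\mathbb R^2$; put $\hat b=b\circ\phi^{-1}$, $\hat A_y=\frac{\partial A}{\partial y}\circ\phi^{-1}$ and, with $D_x=-i\,d/dx$, $$\sigma_0(y,\eta)=\big(\hat b^2+\hat A_y^2\big)(y,\eta)\,D_x^2-\hat A_y(y,\eta)\,(xD_x+D_xx)+x^2 ,$$ regarded as a self-adjoint operator in $L^2(\mathbb R)$ (the closure of this operator on $\mathcal S(\mathbb R)$). In particular $\sigma_0(0,0)=b_0^2D_x^2+x^2$, with normalized ground state $h_0(x)=(\pi b_0)^{-1/4}e^{-x^2/(2b_0)}$. Let $R_-:\mathbb C\to L^2(\mathbb R)$, $R_-\lambda=\lambda h_0$, let $R_+:L^2(\mathbb R)\to\mathbb C$, $R_+u=\int h_0u\,dx$, and for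 $z\in\mathbb C$ let $$\mathcal Q(y,\eta,z)=\begin{pmatrix}\sigma_0(y,\eta)-b_0-z & R_-\\ R_+ & 0\end{pmatrix}$$ in $L^2(\mathbb R)\times\mathbb C$, with domain $\operatorname{Dom}(\sigma_0(y,\eta))\times\mathbb C$. **Proposition 5.3.** There exist an open neighborhood $\Omega$ of $(0,0)$ in $\mathbb R^2$ and $\alpha_0>0$ such that for all $(y,\eta)\in\Omega$ and $z\in\mathbb C$ with $|z|<\alpha_0$ the operator $\mathcal Q(y,\eta,z)$ has a bounded two-sided inverse $$\mathcal E^0(y,\eta,z)=\begin{pmatrix}\epsilon^0&\epsilon^0_-\\ \epsilon^0_+&\epsilon^0_\pm\end{pmatrix}(y,\eta,z),$$ and there is a function $q_0(y,\eta,z)$, $C^\infty$ and elliptic (that is, $|q_0|\ge c$ for some $c>0$) on $\Omega\times\{|z|<\alpha_0\}$, such that there $$\epsilon^0_\pm(y,\eta,z)=-\,q_0(y,\eta,z)\,\big(\hat b(y,\eta)-b_0-z\big),\qquad q_0(0,0,0)=1 .$$ -/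

import Mathlib

open MeasureTheory
open scoped ContDiff SchwartzMap InnerProductSpace

noncomputable section

namespace MagneticGrushin

/-! ### The magnetic field in the adapted coordinates -/

/-- The magnetic field `b = ∂A/∂x` of the potential `A`. -/
def magField (A : ℝ × ℝ → ℝ) (p : ℝ × ℝ) : ℝ := fderiv ℝ A p (1, 0)

/-- The derivative `∂A/∂y`. -/
def potY (A : ℝ × ℝ → ℝ) (p : ℝ × ℝ) : ℝ := fderiv ℝ A p (0, 1)

/-- The change of variables `φ(x, y) = (A(x, y), y)`. -/
def phi (A : ℝ × ℝ → ℝ) (p : ℝ × ℝ) : ℝ × ℝ := (A p, p.2)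

/-- `b̂ = b ∘ φ⁻¹` (`φ` is a bijection of the plane for the potentials considered). -/
def bHat (A : ℝ × ℝ → ℝ) (p : ℝ × ℝ) : ℝ := magField A (Function.invFun (phi A) p)

/-- `Â_y = (∂A/∂y) ∘ φ⁻¹`. -/
def aHat (A : ℝ × ℝ → ℝ) (p : ℝ × ℝ) : ℝ := potY A (Function.invFun (phi A) p)

/-- The standing assumptions on the potential `A` and the number `b₀`: `A` is smooth, `b₀ > 0` is
the minimum of `|b|`, it is attained exactly at the origin, the Hessian of `b` at the origin is
positive definite, and `A` is normalized by `A(0,0) = 0` and `∂A/∂y(0,0) = 0`. -/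
structure IsAdmissible (A : ℝ × ℝ → ℝ) (b₀ : ℝ) : Prop where
  smooth : ContDiff ℝ ∞ A
  pos : 0 < b₀
  le_abs : ∀ p, b₀ ≤ |magField A p|
  abs_eq_iff : ∀ p, |magField A p| = b₀ ↔ p = 0
  hess_pos : ∀ v : ℝ × ℝ, v ≠ 0 → 0 < fderiv ℝ (fderiv ℝ (magField A)) 0 v v
  pot_zero : A 0 = 0
  potY_zero : potY A 0 = 0

/-! ### The harmonic oscillators -/

/-- The Hilbert space `L²(ℝ; ℂ)`. -/
abbrev L2 : Type := Lp ℂ 2 (volume : Measure ℝ)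

/-- `D = -i d/dx` on Schwartz functions. -/
def opD : 𝓢(ℝ, ℂ) →L[ℂ] 𝓢(ℝ, ℂ) := (-Complex.I) • SchwartzMap.derivCLM ℂ ℂ

/-- Multiplication by `x` on Schwartz functions. -/
def opX : 𝓢(ℝ, ℂ) →L[ℂ] 𝓢(ℝ, ℂ) := SchwartzMap.smulLeftCLM ℂ Complex.ofReal

theorem opD_apply (f : 𝓢(ℝ, ℂ)) (x : ℝ) : opD f x = -Complex.I * deriv f x := by
  simp [opD]

theorem opX_apply (f : 𝓢(ℝ, ℂ)) (x : ℝ) : opX f x = (x : ℂ) * f x := by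
  simp [opX, SchwartzMap.smulLeftCLM_apply_apply (g := Complex.ofReal) (by fun_prop)]

/-- The differential operator `(β² + α²) D² - α (x D + D x) + x²` on Schwartz functions. -/
def oscSchwartz (α β : ℝ) : 𝓢(ℝ, ℂ) →L[ℂ] 𝓢(ℝ, ℂ) :=
  ((β ^ 2 + α ^ 2 : ℝ) : ℂ) • (opD ∘L opD) - (α : ℂ) • (opX ∘L opD + opD ∘L opX) + opX ∘L opX

/-- The graph, in `L² × L²`, of the operator `oscSchwartz α β` with domain the Schwartz space. -/
def oscCore (α β : ℝ) : Submodule ℂ (L2 × L2) :=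
  LinearMap.range
    (((SchwartzMap.toLpCLM ℂ ℂ 2 (volume : Measure ℝ)).prod
      (SchwartzMap.toLpCLM ℂ ℂ 2 (volume : Measure ℝ) ∘L oscSchwartz α β)).toLinearMap)

/-- The operator `(β² + α²) D² - α (x D + D x) + x²` as an unbounded operator in `L²(ℝ)`: the
closure of the operator on Schwartz functions (which is essentially self-adjoint). -/
def oscillator (α β : ℝ) : L2 →ₗ.[ℂ] L2 := (oscCore α β).topologicalClosure.toLinearPMap

theorem inner_toLp (f g : 𝓢(ℝ, ℂ)) :
    ⟪f.toLp 2 (volume : Measure ℝ), g.toLp 2 (volume : Measure ℝ)⟫_ℂ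
      = ∫ x, (starRingEnd ℂ) (f x) * g x := by
  simp [mul_comm]

theorem inner_opD (f g : 𝓢(ℝ, ℂ)) :
    ⟪(opD f).toLp 2 (volume : Measure ℝ), g.toLp 2 (volume : Measure ℝ)⟫_ℂ
      = ⟪f.toLp 2 (volume : Measure ℝ), (opD g).toLp 2 (volume : Measure ℝ)⟫_ℂ := by
  rw [inner_toLp, inner_toLp]
  have h := SchwartzMap.integral_bilinear_deriv_right_eq_neg_left f g
    ((ContinuousLinearMap.mul ℝ ℂ).comp (Complex.conjCLE : ℂ →L[ℝ] ℂ))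
  simp only [ContinuousLinearMap.comp_apply, ContinuousLinearMap.mul_apply',
    ContinuousLinearEquiv.coe_coe, Complex.conjCLE_apply] at h
  have e1 : ∀ x, (starRingEnd ℂ) (opD f x) * g x
      = Complex.I * ((starRingEnd ℂ) (deriv f x) * g x) := by
    intro x; rw [opD_apply]; simp; ring
  have e2 : ∀ x, (starRingEnd ℂ) (f x) * opD g x
      = -Complex.I * ((starRingEnd ℂ) (f x) * deriv g x) := by
    intro x; rw [opD_apply]; ring
  simp_rw [e1, e2, integral_const_mul, h]
  ring

theorem inner_opX (f g : 𝓢(ℝ, ℂ)) :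
    ⟪(opX f).toLp 2 (volume : Measure ℝ), g.toLp 2 (volume : Measure ℝ)⟫_ℂ
      = ⟪f.toLp 2 (volume : Measure ℝ), (opX g).toLp 2 (volume : Measure ℝ)⟫_ℂ := by
  rw [inner_toLp, inner_toLp]
  congr 1
  ext x
  rw [opX_apply, opX_apply]
  simp
  ring

/-- `oscSchwartz α β` is symmetric. -/
theorem inner_oscSchwartz (α β : ℝ) (f g : 𝓢(ℝ, ℂ)) :
    ⟪(oscSchwartz α β f).toLp 2 (volume : Measure ℝ), g.toLp 2 (volume : Measure ℝ)⟫_ℂ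
      = ⟪f.toLp 2 (volume : Measure ℝ), (oscSchwartz α β g).toLp 2 (volume : Measure ℝ)⟫_ℂ := by
  have key : ∀ u : 𝓢(ℝ, ℂ), (oscSchwartz α β u).toLp 2 (volume : Measure ℝ)
      = ((β ^ 2 + α ^ 2 : ℝ) : ℂ) • (opD (opD u)).toLp 2 (volume : Measure ℝ)
        - (α : ℂ) • ((opX (opD u)).toLp 2 (volume : Measure ℝ)
          + (opD (opX u)).toLp 2 (volume : Measure ℝ))
        + (opX (opX u)).toLp 2 (volume : Measure ℝ) := by
    intro u
    have h : oscSchwartz α β u = ((β ^ 2 + α ^ 2 : ℝ) : ℂ) • opD (opD u)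
        - (α : ℂ) • (opX (opD u) + opD (opX u)) + opX (opX u) := rfl
    rw [h]
    simp only [← SchwartzMap.toLpCLM_apply (𝕜 := ℂ)]
    rw [map_add, map_sub, map_smul, map_smul, map_add]
  rw [key, key]
  simp only [inner_add_left, inner_sub_left, inner_smul_left, inner_add_right, inner_sub_right,
    inner_smul_right, inner_opD, inner_opX, Complex.conj_ofReal]
  ring

/-- Elements of the closed graph are in duality with the operator on Schwartz functions. -/
theorem inner_of_mem_closure {α β : ℝ} {w : L2 × L2} (hw : w ∈ (oscCore α β).topologicalClosure)
    (g : 𝓢(ℝ, ℂ)) :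
    ⟪w.2, g.toLp 2 (volume : Measure ℝ)⟫_ℂ
      = ⟪w.1, (oscSchwartz α β g).toLp 2 (volume : Measure ℝ)⟫_ℂ := by
  have hcl : IsClosed {w : L2 × L2 | ⟪w.2, g.toLp 2 (volume : Measure ℝ)⟫_ℂ
      = ⟪w.1, (oscSchwartz α β g).toLp 2 (volume : Measure ℝ)⟫_ℂ} :=
    isClosed_eq (by fun_prop) (by fun_prop)
  refine closure_minimal ?_ hcl hw
  rintro _ ⟨f, rfl⟩
  exact inner_oscSchwartz α β f g

/-- The closed graph is the graph of an operator. -/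
theorem closure_single_valued (α β : ℝ) (w : L2 × L2)
    (hw : w ∈ (oscCore α β).topologicalClosure) (h0 : w.1 = 0) : w.2 = 0 := by
  have hd : DenseRange (fun g : 𝓢(ℝ, ℂ) => g.toLp 2 (volume : Measure ℝ)) :=
    SchwartzMap.denseRange_toLpCLM (by simp)
  refine hd.eq_zero_of_inner_left ℂ (fun g => ?_)
  have h := inner_of_mem_closure hw g
  rwa [h0, inner_zero_left] at h

theorem oscillator_graph (α β : ℝ) :
    (oscillator α β).graph = (oscCore α β).topologicalClosure :=
  Submodule.toLinearPMap_graph_eq _ (closure_single_valued α β)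

/-! ### The Grushin problem -/

/-- The function `h₀(x) = π^{-1/4} b₀^{-1/4} e^{-x²/(2 b₀)}`, the normalized ground state of the
harmonic oscillator `b₀² D² + x²`. -/
def groundFun (b₀ : ℝ) (x : ℝ) : ℂ :=
  ((Real.pi * b₀) ^ (-(1 / 4) : ℝ) * Real.exp (-x ^ 2 / (2 * b₀)) : ℝ)

theorem norm_groundFun_sq {b₀ : ℝ} (hb : 0 < b₀) (x : ℝ) :
    ‖groundFun b₀ x‖ ^ 2 = (Real.pi * b₀) ^ (-(1 / 2) : ℝ) * Real.exp (-b₀⁻¹ * x ^ 2) := by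
  have hp : 0 < Real.pi * b₀ := mul_pos Real.pi_pos hb
  rw [groundFun, Complex.norm_real, Real.norm_eq_abs, sq_abs, mul_pow, ← Real.rpow_natCast,
    ← Real.rpow_mul hp.le, ← Real.exp_nat_mul]
  congr 2
  · norm_num
  · field_simp
    push_cast
    ring

theorem memLp_groundFun {b₀ : ℝ} (hb : 0 < b₀) :
    MemLp (groundFun b₀) 2 (volume : Measure ℝ) := by
  have hc : Continuous (groundFun b₀) := by
    unfold groundFun
    fun_prop
  rw [memLp_two_iff_integrable_sq_norm hc.aestronglyMeasurable]
  simp_rw [norm_groundFun_sq hb]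
  exact (integrable_exp_neg_mul_sq (inv_pos.mpr hb)).const_mul _

/-- The ground state `h₀` as an element of `L²(ℝ)`. -/
def groundState (b₀ : ℝ) (hb : 0 < b₀) : L2 := (memLp_groundFun hb).toLp (groundFun b₀)

theorem norm_groundState (b₀ : ℝ) (hb : 0 < b₀) : ‖groundState b₀ hb‖ = 1 := by
  have hp : 0 < Real.pi * b₀ := mul_pos Real.pi_pos hb
  have h : ⟪groundState b₀ hb, groundState b₀ hb⟫_ℂ = 1 := by
    have h1 : ⟪groundState b₀ hb, groundState b₀ hb⟫_ℂ
        = ∫ x, ((‖groundFun b₀ x‖ ^ 2 : ℝ) : ℂ) := by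
      rw [L2.inner_def]
      refine integral_congr_ae ?_
      filter_upwards [(memLp_groundFun hb).coeFn_toLp] with x hx
      rw [groundState, hx, inner_self_eq_norm_sq_to_K]
      simp
    rw [h1, integral_complex_ofReal]
    simp_rw [norm_groundFun_sq hb]
    rw [integral_const_mul, integral_gaussian, div_inv_eq_mul, Real.sqrt_eq_rpow,
      ← Real.rpow_add hp]
    norm_num
  rw [inner_self_eq_norm_sq_to_K] at h
  have h2 : ‖groundState b₀ hb‖ ^ 2 = 1 := Complex.ofReal_injective (by simpa using h)
  nlinarith [norm_nonneg (groundState b₀ hb)]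

/-- The operator `R₋ : ℂ → L²(ℝ)`, `R₋ λ = λ h₀`. -/
def Rminus (b₀ : ℝ) (hb : 0 < b₀) : ℂ →L[ℂ] L2 :=
  ContinuousLinearMap.toSpanSingleton ℂ (groundState b₀ hb)

/-- The operator `R₊ : L²(ℝ) → ℂ`, `R₊ u = ∫ h₀ u` (recall that `h₀` is real). -/
def Rplus (b₀ : ℝ) (hb : 0 < b₀) : L2 →L[ℂ] ℂ := innerSL ℂ (groundState b₀ hb)

theorem Rplus_apply (b₀ : ℝ) (hb : 0 < b₀) (u : L2) :
    Rplus b₀ hb u = ∫ x, groundFun b₀ x * u x := by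
  rw [Rplus, innerSL_apply_apply, L2.inner_def]
  refine integral_congr_ae ?_
  filter_upwards [(memLp_groundFun hb).coeFn_toLp] with x hx
  rw [groundState, hx, RCLike.inner_apply, groundFun, Complex.conj_ofReal, mul_comm]

/-- The operator `σ₀(y, η) = (b̂² + Â_y²) D² - Â_y (x D + D x) + x²` in `L²(ℝ)`, the functions
`b̂`, `Â_y` being evaluated at `p = (y, η)`. -/
def sigmaZero (A : ℝ × ℝ → ℝ) (p : ℝ × ℝ) : L2 →ₗ.[ℂ] L2 := oscillator (aHat A p) (bHat A p)

/-- The Grushin operator `(u, u₋) ↦ ((σ₀(y, η) - b₀ - z) u + R₋ u₋, R₊ u)` in `L²(ℝ) × ℂ`, with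
domain the product of the domain of `σ₀(y, η)` and `ℂ`. -/
def grushin (A : ℝ × ℝ → ℝ) (b₀ : ℝ) (hb : 0 < b₀) (p : ℝ × ℝ) (z : ℂ) :
    (L2 × ℂ) →ₗ.[ℂ] (L2 × ℂ) where
  domain := (sigmaZero A p).domain.prod ⊤
  toFun :=
    { toFun := fun w =>
        (sigmaZero A p ⟨w.1.1, w.2.1⟩ - ((b₀ : ℂ) + z) • w.1.1 + Rminus b₀ hb w.1.2,
          Rplus b₀ hb w.1.1)
      map_add' := by
        intro w w'
        have h : sigmaZero A p ⟨(w + w').1.1, (w + w').2.1⟩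
            = sigmaZero A p ⟨w.1.1, w.2.1⟩ + sigmaZero A p ⟨w'.1.1, w'.2.1⟩ :=
          (sigmaZero A p).map_add ⟨w.1.1, w.2.1⟩ ⟨w'.1.1, w'.2.1⟩
        refine Prod.ext ?_ ?_
        · change sigmaZero A p ⟨(w + w').1.1, (w + w').2.1⟩
              - ((b₀ : ℂ) + z) • (w.1.1 + w'.1.1) + Rminus b₀ hb (w.1.2 + w'.1.2)
            = (sigmaZero A p ⟨w.1.1, w.2.1⟩ - ((b₀ : ℂ) + z) • w.1.1 + Rminus b₀ hb w.1.2)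
              + (sigmaZero A p ⟨w'.1.1, w'.2.1⟩ - ((b₀ : ℂ) + z) • w'.1.1
                + Rminus b₀ hb w'.1.2)
          rw [h, map_add, smul_add]
          abel
        · simp
      map_smul' := by
        intro c w
        have h : sigmaZero A p ⟨(c • w).1.1, (c • w).2.1⟩
            = c • sigmaZero A p ⟨w.1.1, w.2.1⟩ :=
          (sigmaZero A p).map_smul c ⟨w.1.1, w.2.1⟩
        refine Prod.ext ?_ ?_
        · change sigmaZero A p ⟨(c • w).1.1, (c • w).2.1⟩
              - ((b₀ : ℂ) + z) • (c • w.1.1) + Rminus b₀ hb (c • w.1.2)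
            = c • (sigmaZero A p ⟨w.1.1, w.2.1⟩ - ((b₀ : ℂ) + z) • w.1.1 + Rminus b₀ hb w.1.2)
          rw [h, map_smul, smul_add, smul_sub, smul_comm c ((b₀ : ℂ) + z)]
        · simp }

/-- The bounded operator `E` on `L²(ℝ) × ℂ` is the (two-sided) inverse of the unbounded
operator `Q`. -/
def IsInverse (Q : (L2 × ℂ) →ₗ.[ℂ] (L2 × ℂ)) (E : (L2 × ℂ) →L[ℂ] (L2 × ℂ)) : Prop :=
  (∀ v, ∃ h : E v ∈ Q.domain, Q ⟨E v, h⟩ = v) ∧ ∀ w : Q.domain, E (Q w) = w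

/-- The lower right entry of an operator on `L²(ℝ) × ℂ` in block form, a scalar. -/
def scalarEntry (E : (L2 × ℂ) →L[ℂ] (L2 × ℂ)) : ℂ := (E (0, 1)).2

end MagneticGrushin

end

noncomputable section

namespace MagneticGrushin

/-! ### Gaussians as Schwartz functions -/

/-! Write `b` for `b₀`. At the origin `σ₀ - b = a†a` with `a = x + b d/dx` and `[a, a†] = 2b`. The
ladder relations give a spectral gap above `h₀`, so the Grushin operator with `h₀` as auxiliary
state is bounded below on Schwartz functions. Its range is dense because the functions `x^k
exp(-x²/(2b))` are total, so its inverse extends to a bounded operator. The same norm controls all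
quadratic monomials in `a, a†`, hence `D²` and `xD + Dx`.

Therefore the Grushin operator at `(y, η, z)` is `relGrushin` composed with the one at the origin,
where `relGrushin` is a bounded operator, affine in `(b̂² + Â_y² - b², Â_y, z)` and equal to `1` at
zero. It is invertible nearby, with smooth inverse; closedness of the graph carries the inverse from
the Schwartz core to the whole domain (`isInverse_grushinInverse`).

For the scalar entry, `exp(-x²/(2(b̂ + iÂ_y)))` is an exact eigenfunction of `σ₀` with eigenvalue
`b̂` (`oscSchwartz_gaussian`), so `ε±` vanishes at `z' = b̂ - b`. The resolvent identity `ε±(z) -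
ε±(z') = (z - z') ε₊(z) ε₋(z')` then gives the factorization with `q₀ = ε₊(z) ε₋(z')`. This is
smooth without any division, and equals `1` at the origin because there `ε₋` is multiplication of
`h₀` and `ε₊` sends `h₀` to `1`. -/

theorem pow_mul_exp_neg_sq_bounded {p : ℝ} (hp : 0 < p) (n : ℕ) :
    ∃ C : ℝ, ∀ x : ℝ, |x| ^ n * Real.exp (-p * x ^ 2) ≤ C := by
  -- The constant comes from keeping the single term `(p x²)^n / n!` of the series of `exp (p x²)`.
  refine ⟨1 + n.factorial / p ^ n, fun x => ?_⟩
  have h1 : |x| ^ n ≤ 1 + (x ^ 2) ^ n := by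
    have : (x ^ 2) ^ n = (|x| ^ n) ^ 2 := by rw [← sq_abs x]; ring
    rw [this]
    nlinarith [sq_nonneg (|x| ^ n - 1)]
  have h2 : (p * x ^ 2) ^ n / n.factorial ≤ Real.exp (p * x ^ 2) :=
    Real.pow_div_factorial_le_exp _ (by positivity) n
  have h3 : (x ^ 2) ^ n ≤ n.factorial / p ^ n * Real.exp (p * x ^ 2) := by
    rw [div_le_iff₀ (by positivity), mul_pow] at h2
    rw [div_mul_eq_mul_div, le_div_iff₀ (by positivity)]
    linarith
  have h4 : Real.exp (p * x ^ 2) * Real.exp (-p * x ^ 2) = 1 := by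
    rw [← Real.exp_add]; simp
  have h5 : Real.exp (-p * x ^ 2) ≤ 1 := Real.exp_le_one_iff.2 (by nlinarith [sq_nonneg x])
  have h6 := Real.exp_pos (-p * x ^ 2)
  calc |x| ^ n * Real.exp (-p * x ^ 2)
      ≤ (1 + n.factorial / p ^ n * Real.exp (p * x ^ 2)) * Real.exp (-p * x ^ 2) := by
        gcongr; linarith
    _ = Real.exp (-p * x ^ 2) + n.factorial / p ^ n := by
        rw [add_mul, mul_assoc, h4]; ring
    _ ≤ _ := by linarith

theorem polynomial_mul_exp_neg_sq_bounded {p : ℝ} (hp : 0 < p) (P : Polynomial ℂ) (k : ℕ) :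
    ∃ C : ℝ, ∀ x : ℝ, |x| ^ k * (‖P.eval (x : ℂ)‖ * Real.exp (-p * x ^ 2)) ≤ C := by
  induction P using Polynomial.induction_on' with
  | add P Q hP hQ =>
    obtain ⟨C, hC⟩ := hP
    obtain ⟨C', hC'⟩ := hQ
    refine ⟨C + C', fun x => ?_⟩
    have h := norm_add_le (P.eval (x : ℂ)) (Q.eval (x : ℂ))
    rw [Polynomial.eval_add]
    calc |x| ^ k * (‖P.eval (x : ℂ) + Q.eval (x : ℂ)‖ * Real.exp (-p * x ^ 2))
        ≤ |x| ^ k * ((‖P.eval (x : ℂ)‖ + ‖Q.eval (x : ℂ)‖) * Real.exp (-p * x ^ 2)) := by gcongr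
      _ = |x| ^ k * (‖P.eval (x : ℂ)‖ * Real.exp (-p * x ^ 2))
          + |x| ^ k * (‖Q.eval (x : ℂ)‖ * Real.exp (-p * x ^ 2)) := by ring
      _ ≤ _ := add_le_add (hC x) (hC' x)
  | monomial n a =>
    obtain ⟨C, hC⟩ := pow_mul_exp_neg_sq_bounded hp (k + n)
    refine ⟨‖a‖ * C, fun x => ?_⟩
    rw [Polynomial.eval_monomial, norm_mul, norm_pow, Complex.norm_real, Real.norm_eq_abs]
    calc |x| ^ k * (‖a‖ * |x| ^ n * Real.exp (-p * x ^ 2))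
        = ‖a‖ * (|x| ^ (k + n) * Real.exp (-p * x ^ 2)) := by rw [pow_add]; ring
      _ ≤ _ := by gcongr; exact hC x

theorem iteratedDeriv_gaussian (c : ℂ) (n : ℕ) : ∃ P : Polynomial ℂ, ∀ x : ℝ,
    iteratedDeriv n (fun x : ℝ => Complex.exp (-c * (x : ℂ) ^ 2)) x
      = P.eval (x : ℂ) * Complex.exp (-c * (x : ℂ) ^ 2) := by
  induction n with
  | zero => exact ⟨1, by simp⟩
  | succ n ih =>
    obtain ⟨P, hP⟩ := ih
    refine ⟨P.derivative + P * (Polynomial.C (-2 * c) * Polynomial.X), fun x => ?_⟩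
    rw [iteratedDeriv_succ, funext hP]
    have h1 : HasDerivAt (fun z : ℂ => P.eval z * Complex.exp (-c * z ^ 2))
        (P.derivative.eval (x : ℂ) * Complex.exp (-c * (x : ℂ) ^ 2)
          + P.eval (x : ℂ) * (Complex.exp (-c * (x : ℂ) ^ 2) * (-c * (2 * (x : ℂ))))) x := by
      have := ((hasDerivAt_pow 2 (x : ℂ)).const_mul (-c)).cexp
      simpa using! (P.hasDerivAt (x : ℂ)).mul this
    rw [h1.comp_ofReal.deriv]
    simp only [Polynomial.eval_add, Polynomial.eval_mul, Polynomial.eval_C, Polynomial.eval_X]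
    ring

theorem norm_cexp_neg_mul_sq (c : ℂ) (x : ℝ) :
    ‖Complex.exp (-c * (x : ℂ) ^ 2)‖ = Real.exp (-c.re * x ^ 2) := by
  rw [Complex.norm_exp, ← Complex.ofReal_pow, Complex.re_mul_ofReal, Complex.neg_re]

/-- The Gaussian `x ↦ exp (-c x²)`, for `0 < Re c`, as a Schwartz function. -/
def gaussian (c : ℂ) (hc : 0 < c.re) : 𝓢(ℝ, ℂ) where
  toFun x := Complex.exp (-c * (x : ℂ) ^ 2)
  smooth' := by
    have : ContDiff ℝ ∞ (fun x : ℝ => (x : ℂ)) := Complex.ofRealCLM.contDiff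
    fun_prop
  decay' k n := by
    obtain ⟨P, hP⟩ := iteratedDeriv_gaussian c n
    obtain ⟨C, hC⟩ := polynomial_mul_exp_neg_sq_bounded hc P k
    refine ⟨C, fun x => ?_⟩
    rw [norm_iteratedFDeriv_eq_norm_iteratedDeriv, hP, norm_mul, norm_cexp_neg_mul_sq]
    exact hC x

theorem gaussian_apply (c : ℂ) (hc : 0 < c.re) (x : ℝ) :
    gaussian c hc x = Complex.exp (-c * (x : ℂ) ^ 2) := rfl

theorem opD_gaussian (c : ℂ) (hc : 0 < c.re) :
    opD (gaussian c hc) = (2 * c * Complex.I) • opX (gaussian c hc) := by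
  ext x
  rw [opD_apply, _root_.smul_apply, opX_apply, gaussian_apply]
  have h := ((hasDerivAt_pow 2 (x : ℂ)).const_mul (-c)).cexp.comp_ofReal
  have h' : deriv (gaussian c hc) x = _ := h.deriv
  rw [h']
  simp
  ring

theorem opD_opX (f : 𝓢(ℝ, ℂ)) : opD (opX f) = opX (opD f) - Complex.I • f := by
  ext x
  rw [_root_.sub_apply, _root_.smul_apply, opD_apply, opX_apply, opD_apply]
  have h : HasDerivAt (fun y : ℝ => (y : ℂ) * f y) (1 * f x + (x : ℂ) * deriv f x) x :=
    (Complex.ofRealCLM.hasDerivAt (x := x)).mul f.differentiableAt.hasDerivAt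
  rw [show ⇑(opX f) = fun y : ℝ => (y : ℂ) * f y from funext (opX_apply f), h.deriv]
  simp
  ring

theorem oscSchwartz_apply (α β : ℝ) (u : 𝓢(ℝ, ℂ)) :
    oscSchwartz α β u = ((β ^ 2 + α ^ 2 : ℝ) : ℂ) • opD (opD u)
      - (α : ℂ) • (opX (opD u) + opD (opX u)) + opX (opX u) := rfl

/-- Since `D g = 2ic x g`, the image of `g` is a combination of `x² g` and `g`. Factoring `β² + α² =
(β + iα)(β - iα)`, the width condition kills the first coefficient and turns the second into `β`.
The width is genuinely complex when `α ≠ 0`. -/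
theorem oscSchwartz_gaussian {α β : ℝ} {c : ℂ} (hc : 0 < c.re)
    (h : 2 * c * (β + α * Complex.I) = 1) :
    oscSchwartz α β (gaussian c hc) = (β : ℂ) • gaussian c hc := by
  have h1 : -4 * c ^ 2 * (β ^ 2 + α ^ 2) - 4 * c * α * Complex.I + 1 = 0 := by
    have : (β ^ 2 + α ^ 2 : ℂ) = (β + α * Complex.I) * (β - α * Complex.I) := by
      ring_nf; simp
    rw [this]
    linear_combination (-(2 * c * (β - α * Complex.I)) - 1) * h
  have h2 : 2 * c * (β ^ 2 + α ^ 2) + α * Complex.I = β := by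
    have : (β ^ 2 + α ^ 2 : ℂ) = (β + α * Complex.I) * (β - α * Complex.I) := by
      ring_nf; simp
    rw [this]
    linear_combination (β - α * Complex.I) * h
  set g := gaussian c hc
  have hD : opD g = (2 * c * Complex.I) • opX g := opD_gaussian c hc
  have e : oscSchwartz α β g = (-4 * c ^ 2 * (β ^ 2 + α ^ 2) - 4 * c * α * Complex.I + 1) •
      opX (opX g) + (2 * c * (β ^ 2 + α ^ 2) + α * Complex.I : ℂ) • g := by
    rw [oscSchwartz_apply, opD_opX, hD, map_smul, opD_opX, hD, map_smul]
    have hI := Complex.I_sq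
    ext x
    simp
    linear_combination (4 * c ^ 2 * (β ^ 2 + α ^ 2) * opX (opX g) x - (β ^ 2 + α ^ 2) * 2 * c * g x)
      * hI
  rw [e, h1, h2, zero_smul, zero_add]

/-! ### Completeness of the Hermite functions -/

/-- An integrable function with vanishing Fourier transform vanishes almost everywhere. -/
theorem ae_eq_zero_of_fourier_eq_zero {F : ℝ → ℂ} (hF : Integrable F)
    (h : ∀ t : ℝ, FourierTransform.fourier F t = 0) : ∀ᵐ x, F x = 0 := by
  refine ae_eq_zero_of_integral_contDiff_smul_eq_zero hF.locallyIntegrable fun ψ hψ hs => ?_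
  have hs' : HasCompactSupport (fun x => (ψ x : ℂ)) := hs.comp_left Complex.ofReal_zero
  have hψ' : ContDiff ℝ ∞ (fun x => (ψ x : ℂ)) := Complex.ofRealCLM.contDiff.comp hψ
  -- The test function is written as the Fourier transform of a Schwartz function `ρ`; moving the
  -- transform onto `F` makes the pairing vanish.
  set χ : 𝓢(ℝ, ℂ) := hs'.toSchwartzMap hψ' with hχ
  set ρ : 𝓢(ℝ, ℂ) := FourierTransformInv.fourierInv χ with hρ
  have h1 : FourierTransform.fourier ρ = χ := FourierTransform.fourier_fourierInv_eq χ
  have h2 : ∫ x, FourierTransform.fourier F x • ρ x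
      = ∫ x, F x • FourierTransform.fourier (ρ : ℝ → ℂ) x := by
    simpa using! VectorFourier.integral_fourierIntegral_smul_eq_flip (L := innerₗ ℝ)
      Real.continuous_fourierChar continuous_inner hF ρ.integrable
  rw [← SchwartzMap.fourier_coe, h1] at h2
  simp only [h, zero_smul, integral_zero] at h2
  rw [h2]
  refine integral_congr_ae (.of_forall fun x => ?_)
  change ψ x • F x = F x • (ψ x : ℂ)
  simp [mul_comm]

theorem opX_iterate_apply (f : 𝓢(ℝ, ℂ)) (k : ℕ) (x : ℝ) :
    (opX^[k] f) x = (x : ℂ) ^ k * f x := by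
  induction k with
  | zero => simp
  | succ k ih => rw [Function.iterate_succ_apply', opX_apply, ih]; ring

/-- Half of the Gaussian decay absorbs the exponential by completing the square, which is where `exp
(s² / (2 Re c))` comes from; the other half is in `L²`. This supplies the dominating function for
the moment expansion below. -/
theorem integrable_exp_mul_gaussian_mul {c : ℂ} (hc : 0 < c.re) (u : L2) (s : ℝ) :
    Integrable (fun x : ℝ => Real.exp (s * |x|) * (‖gaussian c hc x‖ * ‖u x‖)) := by
  have hc' : 0 < ((c.re / 2 : ℝ) : ℂ).re := by simpa using hc
  have h1 : MemLp (fun x : ℝ => Real.exp (s * |x|) * ‖gaussian c hc x‖) 2 := by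
    refine MemLp.of_le_mul (c := Real.exp (s ^ 2 / (2 * c.re)))
      ((gaussian ((c.re / 2 : ℝ) : ℂ) hc').memLp 2 volume) ?_ (.of_forall fun x => ?_)
    · have := (gaussian c hc).continuous
      exact Continuous.aestronglyMeasurable (by fun_prop)
    · rw [gaussian_apply, gaussian_apply, norm_cexp_neg_mul_sq, norm_cexp_neg_mul_sq,
        Real.norm_eq_abs, abs_of_nonneg (by positivity), ← Real.exp_add, ← Real.exp_add,
        Complex.ofReal_re]
      refine Real.exp_le_exp.2 ?_
      have : s ^ 2 / (2 * c.re) + -(c.re / 2) * x ^ 2 - (s * |x| + -c.re * x ^ 2)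
          = (s - c.re * |x|) ^ 2 / (2 * c.re) := by
        field_simp
        rw [← sq_abs x]
        ring
      have h2 : 0 ≤ (s - c.re * |x|) ^ 2 / (2 * c.re) := by positivity
      linarith
  have h2 := h1.integrable_mul (Lp.memLp u).norm
  refine h2.congr (.of_forall fun x => ?_)
  simp [mul_assoc]

/-- The functions `x ^ k * exp (-c x²)` are total in `L²(ℝ)`. -/
theorem eq_zero_of_inner_opX_iterate_gaussian {c : ℂ} (hc : 0 < c.re) (u : L2)
    (h : ∀ k : ℕ, ⟪(opX^[k] (gaussian c hc)).toLp 2 (volume : Measure ℝ), u⟫_ℂ = 0) : u = 0 := by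
  set g := gaussian c hc
  set F : ℝ → ℂ := fun x => (starRingEnd ℂ) (g x) * u x with hFdef
  have hmeas : AEStronglyMeasurable F volume :=
    (Complex.continuous_conj.comp g.continuous).aestronglyMeasurable.mul
      (Lp.aestronglyMeasurable u)
  have hmom : ∀ k : ℕ, ∫ x : ℝ, (x : ℂ) ^ k * F x = 0 := by
    intro k
    rw [← h k, L2.inner_def]
    refine integral_congr_ae ?_
    filter_upwards [(opX^[k] g).coeFn_toLp 2 (volume : Measure ℝ)] with x hx
    rw [hx, RCLike.inner_apply, opX_iterate_apply, hFdef]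
    simp
    ring
  have hint : Integrable F := by
    refine (integrable_exp_mul_gaussian_mul hc u 0).mono' hmeas (.of_forall fun x => ?_)
    simp [hFdef, g]
  have hfour : ∀ t : ℝ, FourierTransform.fourier F t = 0 := by
    intro t
    rw [Real.fourier_real_eq_integral_exp_smul]
    set τ : ℂ := ((-2 * Real.pi * t : ℝ) : ℂ) * Complex.I with hτ
    -- The Fourier integral is expanded into moments of `F`, all zero; the sum of the dominating
    -- terms is `exp (‖τ‖ |x|) ‖F x‖`.
    have hs : HasSum (fun k : ℕ => ∫ x : ℝ, ((τ * x) ^ k / (k.factorial : ℂ)) * F x)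
        (∫ x : ℝ, Complex.exp (τ * x) * F x) := by
      refine hasSum_integral_of_dominated_convergence
        (fun k x => (‖τ‖ * |x|) ^ k / k.factorial * ‖F x‖) (fun k => ?_)
        (fun k => .of_forall fun x => ?_) (.of_forall fun x => ?_) ?_ (.of_forall fun x => ?_)
      · exact Continuous.aestronglyMeasurable (by fun_prop) |>.mul hmeas
      · simp
      · exact (Real.summable_pow_div_factorial _).mul_right _
      · refine (integrable_exp_mul_gaussian_mul hc u ‖τ‖).congr (.of_forall fun x => ?_)
        have := (NormedSpace.expSeries_div_hasSum_exp (‖τ‖ * |x|)).mul_right ‖F x‖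
        refine Eq.trans ?_ this.tsum_eq.symm
        rw [← Real.exp_eq_exp_ℝ]
        simp [hFdef, g]
      · rw [Complex.exp_eq_exp_ℂ]
        exact (NormedSpace.expSeries_div_hasSum_exp (τ * x)).mul_right _
    have hz : ∀ k : ℕ, ∫ x : ℝ, ((τ * x) ^ k / (k.factorial : ℂ)) * F x = 0 := by
      intro k
      have : ∀ x : ℝ, ((τ * x) ^ k / (k.factorial : ℂ)) * F x
          = (τ ^ k / (k.factorial : ℂ)) * ((x : ℂ) ^ k * F x) := fun x => by ring
      simp_rw [this]
      rw [integral_const_mul, hmom, mul_zero]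
    simp_rw [hz] at hs
    rw [← hasSum_zero.unique hs |>.symm]
    refine integral_congr_ae (.of_forall fun x => ?_)
    simp only [smul_eq_mul, hτ]
    congr 2
    push_cast
    ring
  rw [Lp.eq_zero_iff_ae_eq_zero]
  filter_upwards [ae_eq_zero_of_fourier_eq_zero hint hfour] with x hx
  have hg : g x ≠ 0 := Complex.exp_ne_zero _
  simpa [hFdef, hg] using hx

/-! ### Ladder operators -/

/-- A pair `a`, `ad` of formally adjoint ladder operators with `a ad - ad a = κ > 0`, defined on a
space `V` mapped to a Hilbert space `H`, together with a normalized vacuum vector `g`, such that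
the range of `ad` and the vacuum span a dense subspace. -/
structure IsLadder {V H : Type*} [AddCommGroup V] [Module ℂ V] [NormedAddCommGroup H]
    [InnerProductSpace ℂ H] (J : V →ₗ[ℂ] H) (a ad : V →ₗ[ℂ] V) (κ : ℝ) (g : V) : Prop where
  pos : 0 < κ
  adj : ∀ u v, ⟪J (a u), J v⟫_ℂ = ⟪J u, J (ad v)⟫_ℂ
  comm : ∀ u, a (ad u) = ad (a u) + (κ : ℂ) • u
  vac : a g = 0
  norm_vac : ‖J g‖ = 1
  dense : DenseRange fun p : V × ℂ => J (ad p.1) + p.2 • J g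

namespace IsLadder

variable {V H : Type*} [AddCommGroup V] [Module ℂ V] [NormedAddCommGroup H]
  [InnerProductSpace ℂ H] {J : V →ₗ[ℂ] H} {a ad : V →ₗ[ℂ] V} {κ : ℝ} {g : V}

theorem adj' (L : IsLadder J a ad κ g) (u v : V) : ⟪J (ad u), J v⟫_ℂ = ⟪J u, J (a v)⟫_ℂ := by
  rw [← inner_conj_symm, ← L.adj, inner_conj_symm]

theorem inner_vac_ad (L : IsLadder J a ad κ g) (u : V) : ⟪J g, J (ad u)⟫_ℂ = 0 := by
  rw [← L.adj, L.vac, map_zero, inner_zero_left]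

theorem inner_vac_vac (L : IsLadder J a ad κ g) : ⟪J g, J g⟫_ℂ = 1 := by
  rw [inner_self_eq_norm_sq_to_K, L.norm_vac]; simp

theorem norm_ad_sq (L : IsLadder J a ad κ g) (u : V) :
    ‖J (ad u)‖ ^ 2 = ‖J (a u)‖ ^ 2 + κ * ‖J u‖ ^ 2 := by
  have h : ⟪J (ad u), J (ad u)⟫_ℂ = ⟪J (a u), J (a u)⟫_ℂ + κ * ⟪J u, J u⟫_ℂ := by
    rw [L.adj', L.comm, map_add, map_smul, inner_add_right, inner_smul_right, L.adj]
  simp only [inner_self_eq_norm_sq_to_K] at h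
  exact Complex.ofReal_injective (by push_cast; simpa using h)

/-- Pythagoras: the range of `ad` is orthogonal to the vacuum, as `a g = 0`. -/
theorem norm_le_norm_ad_add (L : IsLadder J a ad κ g) (u : V) (c : ℂ) :
    ‖J (ad u)‖ ≤ ‖J (ad u) + c • J g‖ := by
  have h : ⟪J (ad u), c • J g⟫_ℂ = 0 := by
    rw [inner_smul_right, ← inner_conj_symm, L.inner_vac_ad]; simp
  have := norm_add_sq_eq_norm_sq_add_norm_sq_of_inner_eq_zero _ _ h
  nlinarith [norm_nonneg (J (ad u)), norm_nonneg (J (ad u) + c • J g), norm_nonneg (c • J g)]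

/-- Spectral gap: a lower bound for `a` on the orthogonal complement of the vacuum. -/
theorem spectral_gap (L : IsLadder J a ad κ g) {u : V} (hu : ⟪J u, J g⟫_ℂ = 0) :
    √κ * ‖J u‖ ≤ ‖J (a u)‖ := by
  have hκ := Real.sqrt_pos.2 L.pos
  -- By density one may take `w = a†v + c g`. The vacuum term drops out, the pairing becomes `⟨a u,
  -- v⟩`, and `√κ ‖v‖ ≤ ‖a†v‖ ≤ ‖w‖`. The gap follows with `w = J u`, without diagonalizing
  -- anything.
  have key : ∀ w : H, √κ * ‖⟪J u, w⟫_ℂ‖ ≤ ‖J (a u)‖ * ‖w‖ := by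
    intro w
    induction w using L.dense.induction_on with
    | hp => exact isClosed_le (by fun_prop) (by fun_prop)
    | ih p =>
      obtain ⟨v, c⟩ := p
      have h1 : ⟪J u, J (ad v) + c • J g⟫_ℂ = ⟪J (a u), J v⟫_ℂ := by
        rw [inner_add_right, inner_smul_right, hu, mul_zero, add_zero, L.adj]
      have h2 : √κ * ‖J v‖ ≤ ‖J (ad v)‖ := by
        refine abs_le_of_sq_le_sq' ?_ (norm_nonneg _) |>.2
        rw [mul_pow, Real.sq_sqrt L.pos.le, L.norm_ad_sq]
        nlinarith [sq_nonneg ‖J (a v)‖]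
      have h3 := L.norm_le_norm_ad_add v c
      calc √κ * ‖⟪J u, J (ad v) + c • J g⟫_ℂ‖ ≤ √κ * (‖J (a u)‖ * ‖J v‖) := by
            rw [h1]; gcongr; exact norm_inner_le_norm _ _
        _ = ‖J (a u)‖ * (√κ * ‖J v‖) := by ring
        _ ≤ ‖J (a u)‖ * ‖J (ad v) + c • J g‖ := by gcongr; exact h2.trans h3
  have h := key (J u)
  rw [inner_self_eq_norm_sq_to_K] at h
  simp only [norm_pow, Complex.coe_algebraMap, Complex.norm_real, norm_norm] at h
  rcases (norm_nonneg (J u)).eq_or_lt with h0 | h0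
  · rw [← h0, mul_zero]; exact norm_nonneg _
  · exact le_of_mul_le_mul_right (by nlinarith) h0

/-- The Grushin operator of the number operator `ad a`, with the vacuum as auxiliary state. -/
def grushinCore (J : V →ₗ[ℂ] H) (a ad : V →ₗ[ℂ] V) (g : V) : V × ℂ →ₗ[ℂ] H × ℂ :=
  LinearMap.prod
    ((J ∘ₗ ad ∘ₗ a) ∘ₗ LinearMap.fst ℂ V ℂ
      + (LinearMap.toSpanSingleton ℂ H (J g)) ∘ₗ LinearMap.snd ℂ V ℂ)
    ((innerSL ℂ (J g)).toLinearMap ∘ₗ J ∘ₗ LinearMap.fst ℂ V ℂ)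

theorem grushinCore_apply (J : V →ₗ[ℂ] H) (a ad : V →ₗ[ℂ] V) (g : V) (w : V × ℂ) :
    grushinCore J a ad g w = (J (ad (a w.1)) + w.2 • J g, ⟪J g, J w.1⟫_ℂ) := rfl

theorem norm_snd_le (L : IsLadder J a ad κ g) (w : V × ℂ) :
    ‖w.2‖ ≤ ‖grushinCore J a ad g w‖ := by
  have h : ⟪J g, J (ad (a w.1)) + w.2 • J g⟫_ℂ = w.2 := by
    rw [inner_add_right, inner_smul_right, L.inner_vac_ad, L.inner_vac_vac]; simp
  calc ‖w.2‖ ≤ ‖J g‖ * ‖J (ad (a w.1)) + w.2 • J g‖ := by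
        conv_lhs => rw [← h]
        exact norm_inner_le_norm _ _
    _ ≤ _ := by rw [L.norm_vac, one_mul]; exact norm_fst_le (grushinCore J a ad g w)

theorem norm_number_le (L : IsLadder J a ad κ g) (w : V × ℂ) :
    ‖J (ad (a w.1))‖ ≤ ‖grushinCore J a ad g w‖ :=
  (L.norm_le_norm_ad_add _ _).trans (norm_fst_le (grushinCore J a ad g w))

theorem norm_fst_le (L : IsLadder J a ad κ g) (w : V × ℂ) :
    ‖J w.1‖ ≤ (1 + κ⁻¹) * ‖grushinCore J a ad g w‖ := by
  obtain ⟨u, c⟩ := w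
  -- The vacuum component of `u` is the second Grushin component; the orthogonal remainder `v` is
  -- controlled by `κ ‖v‖ ≤ √κ ‖a u‖ ≤ ‖a†a u‖`.
  set v := u - ⟪J g, J u⟫_ℂ • g with hv
  have hav : a v = a u := by rw [hv, map_sub, map_smul, L.vac, smul_zero, sub_zero]
  have horth : ⟪J v, J g⟫_ℂ = 0 := by
    rw [hv, map_sub, map_smul, inner_sub_left, inner_smul_left, L.inner_vac_vac, inner_conj_symm,
      mul_one, sub_self]
  have h1 := L.spectral_gap horth
  have h2 : √κ * ‖J (a u)‖ ≤ ‖J (ad (a u))‖ := by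
    refine abs_le_of_sq_le_sq' ?_ (norm_nonneg _) |>.2
    rw [mul_pow, Real.sq_sqrt L.pos.le, L.norm_ad_sq]
    nlinarith [sq_nonneg ‖J (a (a u))‖]
  have h3 : κ * ‖J v‖ ≤ ‖grushinCore J a ad g (u, c)‖ := by
    calc κ * ‖J v‖ = √κ * (√κ * ‖J v‖) := by rw [← mul_assoc, Real.mul_self_sqrt L.pos.le]
      _ ≤ √κ * ‖J (a u)‖ := by rw [← hav]; gcongr
      _ ≤ _ := h2.trans (L.norm_number_le (u, c))
  have h4 : ‖⟪J g, J u⟫_ℂ‖ ≤ ‖grushinCore J a ad g (u, c)‖ :=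
    _root_.norm_snd_le (grushinCore J a ad g (u, c))
  have h5 : J u = J v + ⟪J g, J u⟫_ℂ • J g := by rw [hv, map_sub, map_smul, sub_add_cancel]
  have h6 : ‖J v‖ ≤ κ⁻¹ * ‖grushinCore J a ad g (u, c)‖ := by
    rw [inv_mul_eq_div, le_div_iff₀ L.pos]; linarith
  calc ‖J u‖ ≤ ‖J v‖ + ‖⟪J g, J u⟫_ℂ‖ * ‖J g‖ := by
        conv_lhs => rw [h5]
        exact (norm_add_le _ _).trans_eq (by rw [norm_smul])
    _ ≤ _ := by rw [L.norm_vac]; linarith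

theorem norm_a_a_le (L : IsLadder J a ad κ g) (w : V × ℂ) :
    ‖J (a (a w.1))‖ ≤ ‖grushinCore J a ad g w‖ := by
  refine le_trans ?_ (L.norm_number_le w)
  refine abs_le_of_sq_le_sq' ?_ (norm_nonneg _) |>.2
  rw [L.norm_ad_sq]
  have := L.pos
  have : 0 ≤ κ * ‖J (a w.1)‖ ^ 2 := by positivity
  linarith

theorem norm_a_ad_le (L : IsLadder J a ad κ g) (w : V × ℂ) :
    ‖J (a (ad w.1))‖ ≤ (2 + κ) * ‖grushinCore J a ad g w‖ := by
  have hκ := L.pos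
  rw [L.comm, map_add, map_smul]
  refine (norm_add_le _ _).trans ?_
  rw [norm_smul, Complex.norm_real, Real.norm_eq_abs, abs_of_pos hκ]
  have h1 := mul_le_mul_of_nonneg_left (L.norm_fst_le w) hκ.le
  have h2 : κ * ((1 + κ⁻¹) * ‖grushinCore J a ad g w‖)
    = (1 + κ) * ‖grushinCore J a ad g w‖ := by field_simp; ring
  linarith [L.norm_number_le w]

/-- The commutator gives `‖a†a†u‖² = ‖a a†u‖² + κ ‖a†u‖²`, and `‖a†u‖² ≤ ‖u‖ ‖a a†u‖` by
Cauchy–Schwarz. This completes the control of the four quadratic monomials in `a, a†`; the factor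
`2` is not sharp. -/
theorem norm_ad_ad_le (L : IsLadder J a ad κ g) (w : V × ℂ) :
    ‖J (ad (ad w.1))‖ ≤ 2 * (2 + κ) * ‖grushinCore J a ad g w‖ := by
  have hκ := L.pos
  refine abs_le_of_sq_le_sq' ?_ (by positivity) |>.2
  have h1 := L.norm_a_ad_le w
  have h2 : κ * ‖J (ad w.1)‖ ^ 2 ≤ ‖J (a (ad w.1))‖ ^ 2 + κ ^ 2 * ‖J w.1‖ ^ 2 := by
    have e1 := L.norm_ad_sq (a w.1)
    have e2 := L.norm_ad_sq w.1
    have e3 : ‖J (ad w.1)‖ ^ 2 ≤ ‖J w.1‖ * ‖J (a (ad w.1))‖ := by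
      have : ‖⟪J (ad w.1), J (ad w.1)⟫_ℂ‖ ≤ ‖J w.1‖ * ‖J (a (ad w.1))‖ := by
        rw [L.adj']; exact norm_inner_le_norm _ _
      rwa [inner_self_eq_norm_sq_to_K, norm_pow, RCLike.norm_ofReal, abs_norm] at this
    nlinarith [sq_nonneg (κ * ‖J w.1‖ - ‖J (a (ad w.1))‖), sq_nonneg (κ * ‖J w.1‖),
      sq_nonneg (‖J (a (ad w.1))‖)]
  have h3 : κ * ‖J w.1‖ ≤ (1 + κ) * ‖grushinCore J a ad g w‖ := by
    have h1 := mul_le_mul_of_nonneg_left (L.norm_fst_le w) hκ.le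
    have h2 : κ * ((1 + κ⁻¹) * ‖grushinCore J a ad g w‖)
      = (1 + κ) * ‖grushinCore J a ad g w‖ := by field_simp; ring
    linarith
  have h4 := pow_le_pow_left₀ (by positivity) h1 2
  have h5 := pow_le_pow_left₀ (by positivity) h3 2
  have h6 : (1 + κ) ^ 2 ≤ (2 + κ) ^ 2 := by nlinarith
  have h7 := mul_le_mul_of_nonneg_right h6 (sq_nonneg ‖grushinCore J a ad g w‖)
  rw [L.norm_ad_sq]
  nlinarith [sq_nonneg ((2 + κ) * ‖grushinCore J a ad g w‖)]

theorem denseRange_grushinCore (L : IsLadder J a ad κ g)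
    (h : DenseRange fun p : V × ℂ => J (ad (a p.1)) + p.2 • J g) :
    DenseRange (grushinCore J a ad g) := by
  have hcl : ∀ u : H, (u, (0 : ℂ)) ∈ closure (Set.range (grushinCore J a ad g)) := by
    intro u
    induction u using h.induction_on with
    | hp => exact isClosed_closure.preimage (by fun_prop)
    | ih p =>
      -- Removing the vacuum component makes the second entry zero and leaves `a` of the vector
      -- unchanged.
      refine subset_closure ⟨(p.1 - ⟪J g, J p.1⟫_ℂ • g, p.2), ?_⟩
      rw [grushinCore_apply]
      simp only [map_sub, map_smul, L.vac, smul_zero, sub_zero, inner_sub_right, inner_smul_right,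
        L.inner_vac_vac, mul_one, sub_self]
  have hsub : ∀ w : H × ℂ, w ∈ (LinearMap.range (grushinCore J a ad g)).topologicalClosure := by
    rintro ⟨u, c⟩
    have h1 : (u, (0 : ℂ)) ∈ (LinearMap.range (grushinCore J a ad g)).topologicalClosure := hcl u
    have h2 : ((0 : H), (1 : ℂ)) ∈ (LinearMap.range (grushinCore J a ad g)).topologicalClosure := by
      refine Submodule.le_topologicalClosure _ ⟨(g, 0), ?_⟩
      rw [grushinCore_apply]
      simp [L.vac, L.norm_vac]
    have h3 := Submodule.add_mem _ h1 (Submodule.smul_mem _ c h2)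
    simpa using h3
  exact hsub

end IsLadder

/-! ### The ladder operators of the harmonic oscillator -/

/-- The inclusion of the Schwartz space in `L²(ℝ)`. -/
def toL2 : 𝓢(ℝ, ℂ) →ₗ[ℂ] L2 := (SchwartzMap.toLpCLM ℂ ℂ 2 (volume : Measure ℝ)).toLinearMap

theorem toL2_apply (f : 𝓢(ℝ, ℂ)) : toL2 f = f.toLp 2 (volume : Measure ℝ) := rfl

/-- The annihilation operator `x + b d/dx`. -/
def annihilation (b : ℝ) : 𝓢(ℝ, ℂ) →ₗ[ℂ] 𝓢(ℝ, ℂ) :=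
  (opX + ((b : ℂ) * Complex.I) • opD).toLinearMap

/-- The creation operator `x - b d/dx`. -/
def creation (b : ℝ) : 𝓢(ℝ, ℂ) →ₗ[ℂ] 𝓢(ℝ, ℂ) :=
  (opX - ((b : ℂ) * Complex.I) • opD).toLinearMap

theorem annihilation_apply (b : ℝ) (u : 𝓢(ℝ, ℂ)) :
    annihilation b u = opX u + ((b : ℂ) * Complex.I) • opD u := rfl

theorem creation_apply (b : ℝ) (u : 𝓢(ℝ, ℂ)) :
    creation b u = opX u - ((b : ℂ) * Complex.I) • opD u := rfl

theorem annihilation_creation (b : ℝ) (u : 𝓢(ℝ, ℂ)) :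
    annihilation b (creation b u) = creation b (annihilation b u) + ((2 * b : ℝ) : ℂ) • u := by
  simp only [annihilation_apply, creation_apply, map_add, map_sub, map_smul, opD_opX]
  have hI := Complex.I_sq
  ext x
  simp
  linear_combination (-2 * b * u x) * hI

theorem inner_annihilation (b : ℝ) (u v : 𝓢(ℝ, ℂ)) :
    ⟪toL2 (annihilation b u), toL2 v⟫_ℂ = ⟪toL2 u, toL2 (creation b v)⟫_ℂ := by
  simp only [annihilation_apply, creation_apply, map_add, map_sub, map_smul, inner_add_left,
    inner_sub_right, inner_smul_left, inner_smul_right, toL2_apply, inner_opD, inner_opX]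
  simp
  ring

theorem opD_opD_eq_ladder {b : ℝ} (hb : b ≠ 0) (u : 𝓢(ℝ, ℂ)) :
    opD (opD u) = (-(4 * (b : ℂ) ^ 2)⁻¹) • (annihilation b (annihilation b u)
      - annihilation b (creation b u) - creation b (annihilation b u)
      + creation b (creation b u)) := by
  have hI := Complex.I_sq
  have hb' : (b : ℂ) ≠ 0 := Complex.ofReal_ne_zero.2 hb
  simp only [annihilation_apply, creation_apply, map_add, map_sub, map_smul]
  ext x
  simp
  field_simp
  linear_combination (4 * (b : ℂ) ^ 2 * opD (opD u) x) * hI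

/-- Substitute `x = (a + a†)/2` and `D = -i(a - a†)/(2b)`; the symmetrization cancels the mixed
products. -/
theorem opX_opD_add_eq_ladder {b : ℝ} (hb : b ≠ 0) (u : 𝓢(ℝ, ℂ)) :
    opX (opD u) + opD (opX u) = (-Complex.I / (2 * (b : ℂ))) •
      (annihilation b (annihilation b u) - creation b (creation b u)) := by
  have hI := Complex.I_sq
  have hb' : (b : ℂ) ≠ 0 := Complex.ofReal_ne_zero.2 hb
  simp only [annihilation_apply, creation_apply, map_add, map_sub, map_smul]
  ext x
  simp
  field_simp
  linear_combination (2 * (b : ℂ) * (opX (opD u) x + opD (opX u) x)) * hI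

/-- Since `a†a = b²D² + x² - b`, this isolates the unperturbed oscillator; the two remaining terms
are the perturbation. -/
theorem oscSchwartz_eq_ladder (α β b : ℝ) (u : 𝓢(ℝ, ℂ)) :
    oscSchwartz α β u = creation b (annihilation b u) + (b : ℂ) • u
      + ((β ^ 2 + α ^ 2 - b ^ 2 : ℝ) : ℂ) • opD (opD u)
      - (α : ℂ) • (opX (opD u) + opD (opX u)) := by
  have hI := Complex.I_sq
  simp only [oscSchwartz_apply, annihilation_apply, creation_apply, map_add, map_smul, opD_opX]
  ext x
  simp
  linear_combination ((b : ℂ) ^ 2 * opD (opD u) x - b * u x) * hI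

theorem re_width_pos {b : ℝ} (hb : 0 < b) : 0 < (((2 * b)⁻¹ : ℝ) : ℂ).re := by
  rw [Complex.ofReal_re]; positivity

/-- The Hermite-type functions `x ^ k * exp (-x² / (2 b))`. -/
def gaussianMoment (b : ℝ) (hb : 0 < b) (k : ℕ) : 𝓢(ℝ, ℂ) :=
  opX^[k] (gaussian _ (re_width_pos hb))

theorem opX_gaussianMoment {b : ℝ} (hb : 0 < b) (k : ℕ) :
    opX (gaussianMoment b hb k) = gaussianMoment b hb (k + 1) :=
  (Function.iterate_succ_apply' _ _ _).symm

theorem opD_gaussianMoment_zero {b : ℝ} (hb : 0 < b) :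
    opD (gaussianMoment b hb 0) = (Complex.I / b) • gaussianMoment b hb 1 := by
  have hb' : (b : ℂ) ≠ 0 := Complex.ofReal_ne_zero.2 hb.ne'
  refine (opD_gaussian _ (re_width_pos hb)).trans ?_
  change _ • gaussianMoment b hb 1 = _
  congr 1
  push_cast
  field_simp

theorem opD_gaussianMoment_succ {b : ℝ} (hb : 0 < b) (k : ℕ) :
    opD (gaussianMoment b hb (k + 1)) = (Complex.I / b) • gaussianMoment b hb (k + 2)
      - (Complex.I * (k + 1)) • gaussianMoment b hb k := by
  induction k with
  | zero =>
    rw [← opX_gaussianMoment, opD_opX, opD_gaussianMoment_zero, map_smul, opX_gaussianMoment]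
    simp
  | succ k ih =>
    rw [← opX_gaussianMoment, opD_opX, ih, map_sub, map_smul, map_smul, opX_gaussianMoment,
      opX_gaussianMoment]
    push_cast
    module

theorem annihilation_gaussianMoment_zero {b : ℝ} (hb : 0 < b) :
    annihilation b (gaussianMoment b hb 0) = 0 := by
  have hb' : (b : ℂ) ≠ 0 := Complex.ofReal_ne_zero.2 hb.ne'
  have h : (b : ℂ) * Complex.I * (Complex.I / b) = -1 := by field_simp; exact Complex.I_sq
  rw [annihilation_apply, opX_gaussianMoment, opD_gaussianMoment_zero, smul_smul, h]
  module

/-- As `a` kills the Gaussian, it acts as `b d/dx` on the polynomial factor. Hence every moment is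
in the range of `a`. -/
theorem annihilation_gaussianMoment_succ {b : ℝ} (hb : 0 < b) (k : ℕ) :
    annihilation b (gaussianMoment b hb (k + 1))
      = ((b : ℂ) * (k + 1)) • gaussianMoment b hb k := by
  have hb' : (b : ℂ) ≠ 0 := Complex.ofReal_ne_zero.2 hb.ne'
  have h : (b : ℂ) * Complex.I * (Complex.I / b) = -1 := by field_simp; exact Complex.I_sq
  have h' : (b : ℂ) * Complex.I * (Complex.I * (k + 1)) = -((b : ℂ) * (k + 1)) := by
    linear_combination ((b : ℂ) * (k + 1)) * Complex.I_sq
  rw [annihilation_apply, opX_gaussianMoment, opD_gaussianMoment_succ, smul_sub, smul_smul,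
    smul_smul, h, h']
  module

theorem creation_gaussianMoment_zero {b : ℝ} (hb : 0 < b) :
    creation b (gaussianMoment b hb 0) = (2 : ℂ) • gaussianMoment b hb 1 := by
  have hb' : (b : ℂ) ≠ 0 := Complex.ofReal_ne_zero.2 hb.ne'
  have h : (b : ℂ) * Complex.I * (Complex.I / b) = -1 := by field_simp; exact Complex.I_sq
  rw [creation_apply, opX_gaussianMoment, opD_gaussianMoment_zero, smul_smul, h]
  module

theorem creation_gaussianMoment_succ {b : ℝ} (hb : 0 < b) (k : ℕ) :
    creation b (gaussianMoment b hb (k + 1)) = (2 : ℂ) • gaussianMoment b hb (k + 2)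
      - ((b : ℂ) * (k + 1)) • gaussianMoment b hb k := by
  have hb' : (b : ℂ) ≠ 0 := Complex.ofReal_ne_zero.2 hb.ne'
  have h : (b : ℂ) * Complex.I * (Complex.I / b) = -1 := by field_simp; exact Complex.I_sq
  have h' : (b : ℂ) * Complex.I * (Complex.I * (k + 1)) = -((b : ℂ) * (k + 1)) := by
    linear_combination ((b : ℂ) * (k + 1)) * Complex.I_sq
  rw [creation_apply, opX_gaussianMoment, opD_gaussianMoment_succ, smul_sub, smul_smul,
    smul_smul, h, h']
  module

/-- A subspace of `L²(ℝ)` containing the ground state and the images under the creation operator of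
all Hermite-type functions is dense. -/
theorem dense_of_creation_gaussianMoment_mem {b : ℝ} (hb : 0 < b) (P : Submodule ℂ L2)
    (h0 : toL2 (gaussianMoment b hb 0) ∈ P)
    (h : ∀ k, toL2 (creation b (gaussianMoment b hb k)) ∈ P) : Dense (P : Set L2) := by
  -- `a†` links the moments `k` and `k + 2`, so the induction carries two consecutive ones.
  have hmem : ∀ k, toL2 (gaussianMoment b hb k) ∈ P ∧ toL2 (gaussianMoment b hb (k + 1)) ∈ P := by
    intro k
    induction k with
    | zero =>
      refine ⟨h0, ?_⟩
      have := h 0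
      rw [creation_gaussianMoment_zero, map_smul] at this
      exact (P.smul_mem_iff two_ne_zero).1 this
    | succ k ih =>
      refine ⟨ih.2, ?_⟩
      have h1 := h (k + 1)
      rw [creation_gaussianMoment_succ, map_sub, map_smul, map_smul] at h1
      have h2 := P.add_mem h1 (P.smul_mem ((b : ℂ) * (k + 1)) ih.1)
      rw [sub_add_cancel] at h2
      exact (P.smul_mem_iff two_ne_zero).1 h2
  rw [Submodule.dense_iff_topologicalClosure_eq_top, Submodule.topologicalClosure_eq_top_iff,
    Submodule.eq_bot_iff]
  intro u hu
  exact eq_zero_of_inner_opX_iterate_gaussian (re_width_pos hb) u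
    fun k => (Submodule.mem_orthogonal _ _).1 hu _ (hmem k).1

/-- The ground state as a Schwartz function. -/
def vacuum (b : ℝ) (hb : 0 < b) : 𝓢(ℝ, ℂ) :=
  (((Real.pi * b) ^ (-(1 / 4) : ℝ) : ℝ) : ℂ) • gaussianMoment b hb 0

theorem toL2_vacuum (b : ℝ) (hb : 0 < b) : toL2 (vacuum b hb) = groundState b hb := by
  refine Lp.ext ?_
  filter_upwards [(memLp_groundFun hb).coeFn_toLp,
    (vacuum b hb).coeFn_toLp 2 (volume : Measure ℝ)] with x h1 h2
  rw [groundState, h1, toL2_apply, h2, vacuum, _root_.smul_apply]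
  change _ * Complex.exp _ = _
  rw [groundFun, Complex.ofReal_mul, Complex.ofReal_exp]
  congr 2
  push_cast
  field_simp

/-- Used twice: with `T = a†` for the ladder structure, and with `T = a†a` for the range of the
Grushin operator. -/
theorem dense_range_vacuum {b : ℝ} (hb : 0 < b) (T : 𝓢(ℝ, ℂ) →ₗ[ℂ] 𝓢(ℝ, ℂ))
    (hT : ∀ k, ∃ u, T u = creation b (gaussianMoment b hb k)) :
    DenseRange fun p : 𝓢(ℝ, ℂ) × ℂ => toL2 (T p.1) + p.2 • toL2 (vacuum b hb) := by
  have hN : (((Real.pi * b) ^ (-(1 / 4) : ℝ) : ℝ) : ℂ) ≠ 0 :=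
    Complex.ofReal_ne_zero.2 (Real.rpow_pos_of_pos (mul_pos Real.pi_pos hb) _).ne'
  refine dense_of_creation_gaussianMoment_mem hb (LinearMap.range
    ((toL2 ∘ₗ T) ∘ₗ LinearMap.fst ℂ 𝓢(ℝ, ℂ) ℂ
      + (LinearMap.toSpanSingleton ℂ L2 (toL2 (vacuum b hb))) ∘ₗ LinearMap.snd ℂ 𝓢(ℝ, ℂ) ℂ))
    ⟨(0, (((Real.pi * b) ^ (-(1 / 4) : ℝ) : ℝ) : ℂ)⁻¹), ?_⟩ fun k => ?_
  · unfold vacuum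
    generalize (((Real.pi * b) ^ (-(1 / 4) : ℝ) : ℝ) : ℂ) = N at hN ⊢
    simp [smul_smul, inv_mul_cancel₀ hN]
  · obtain ⟨u, hu⟩ := hT k
    exact ⟨(u, 0), by simp [hu]⟩

theorem isLadder {b : ℝ} (hb : 0 < b) :
    IsLadder toL2 (annihilation b) (creation b) (2 * b) (vacuum b hb) where
  pos := by positivity
  adj := inner_annihilation b
  comm := annihilation_creation b
  vac := by rw [vacuum, map_smul, annihilation_gaussianMoment_zero, smul_zero]
  norm_vac := by rw [toL2_vacuum, norm_groundState]
  dense := dense_range_vacuum hb _ fun k => ⟨_, rfl⟩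

/-- The Grushin operator at the base point, on Schwartz functions. -/
def baseGrushin (b : ℝ) (hb : 0 < b) : 𝓢(ℝ, ℂ) × ℂ →ₗ[ℂ] L2 × ℂ :=
  IsLadder.grushinCore toL2 (annihilation b) (creation b) (vacuum b hb)

theorem denseRange_baseGrushin {b : ℝ} (hb : 0 < b) : DenseRange (baseGrushin b hb) := by
  have hb' : (b : ℂ) ≠ 0 := Complex.ofReal_ne_zero.2 hb.ne'
  refine (isLadder hb).denseRange_grushinCore
    (dense_range_vacuum hb (creation b ∘ₗ annihilation b) fun k =>
      ⟨((b : ℂ) * (k + 1))⁻¹ • gaussianMoment b hb (k + 1), ?_⟩)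
  have : (b : ℂ) * (k + 1) ≠ 0 := mul_ne_zero hb' (by exact_mod_cast k.succ_ne_zero)
  rw [LinearMap.comp_apply, map_smul, annihilation_gaussianMoment_succ, smul_smul,
    inv_mul_cancel₀ this, one_smul]

/-! ### The Grushin problem near the harmonic oscillator -/

/-- `D²` as a linear map from the Schwartz space to `L²(ℝ)`. -/
def coreDD : 𝓢(ℝ, ℂ) × ℂ →ₗ[ℂ] L2 :=
  toL2 ∘ₗ (opD ∘L opD).toLinearMap ∘ₗ LinearMap.fst ℂ 𝓢(ℝ, ℂ) ℂ

/-- `x D + D x` as a linear map from the Schwartz space to `L²(ℝ)`. -/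
def coreXD : 𝓢(ℝ, ℂ) × ℂ →ₗ[ℂ] L2 :=
  toL2 ∘ₗ (opX ∘L opD + opD ∘L opX).toLinearMap ∘ₗ LinearMap.fst ℂ 𝓢(ℝ, ℂ) ℂ

/-- The inclusion of `𝓢(ℝ) × ℂ` in `L²(ℝ) × ℂ`. -/
def coreInclusion : 𝓢(ℝ, ℂ) × ℂ →ₗ[ℂ] L2 × ℂ := toL2.prodMap LinearMap.id

theorem coreDD_apply (w : 𝓢(ℝ, ℂ) × ℂ) : coreDD w = toL2 (opD (opD w.1)) := rfl

theorem coreXD_apply (w : 𝓢(ℝ, ℂ) × ℂ) :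
    coreXD w = toL2 (opX (opD w.1) + opD (opX w.1)) := rfl

theorem coreInclusion_apply (w : 𝓢(ℝ, ℂ) × ℂ) : coreInclusion w = (toL2 w.1, w.2) := rfl

theorem baseGrushin_apply {b : ℝ} (hb : 0 < b) (w : 𝓢(ℝ, ℂ) × ℂ) :
    baseGrushin b hb w = (toL2 (creation b (annihilation b w.1)) + w.2 • groundState b hb,
      ⟪groundState b hb, toL2 w.1⟫_ℂ) := by
  rw [baseGrushin, IsLadder.grushinCore_apply, toL2_vacuum]

/-- This bound and the next two are what allows extending by continuity, from the dense range of
`baseGrushin`, the maps "invert, then include, apply `D²`, or apply `xD + Dx`". -/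
theorem coreInclusion_bound {b : ℝ} (hb : 0 < b) :
    ∃ C, ∀ w, ‖coreInclusion w‖ ≤ C * ‖baseGrushin b hb w‖ := by
  refine ⟨1 + (2 * b)⁻¹, fun w => ?_⟩
  have h1 := (isLadder hb).norm_fst_le w
  have h2 := (isLadder hb).norm_snd_le w
  rw [coreInclusion_apply, Prod.norm_def]
  refine max_le h1 (h2.trans (le_mul_of_one_le_left (norm_nonneg _) ?_))
  have : 0 < (2 * b)⁻¹ := by positivity
  linarith

theorem coreDD_bound {b : ℝ} (hb : 0 < b) :
    ∃ C, ∀ w, ‖coreDD w‖ ≤ C * ‖baseGrushin b hb w‖ := by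
  refine ⟨‖-(4 * (b : ℂ) ^ 2)⁻¹‖ * (1 + (2 + 2 * b) + 1 + 2 * (2 + 2 * b)), fun w => ?_⟩
  have h1 := (isLadder hb).norm_a_a_le w
  have h2 := (isLadder hb).norm_a_ad_le w
  have h3 := (isLadder hb).norm_number_le w
  have h4 := (isLadder hb).norm_ad_ad_le w
  rw [coreDD_apply, opD_opD_eq_ladder hb.ne', map_smul, norm_smul, mul_assoc]
  refine mul_le_mul_of_nonneg_left ?_ (norm_nonneg _)
  rw [map_add, map_sub, map_sub]
  refine (norm_add_le _ _).trans ((add_le_add (norm_sub_le _ _) h4).trans ?_)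
  have h5 := norm_sub_le (toL2 (annihilation b (annihilation b w.1)))
    (toL2 (annihilation b (creation b w.1)))
  rw [baseGrushin]
  linarith

theorem coreXD_bound {b : ℝ} (hb : 0 < b) :
    ∃ C, ∀ w, ‖coreXD w‖ ≤ C * ‖baseGrushin b hb w‖ := by
  refine ⟨‖-Complex.I / (2 * (b : ℂ))‖ * (1 + 2 * (2 + 2 * b)), fun w => ?_⟩
  have h1 := (isLadder hb).norm_a_a_le w
  have h4 := (isLadder hb).norm_ad_ad_le w
  rw [coreXD_apply, opX_opD_add_eq_ladder hb.ne', map_smul, norm_smul, mul_assoc]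
  refine mul_le_mul_of_nonneg_left ?_ (norm_nonneg _)
  rw [map_sub]
  refine (norm_sub_le _ _).trans ?_
  rw [baseGrushin]
  linarith

/-- The inverse of the Grushin operator at the base point. -/
def baseInverse (b : ℝ) (hb : 0 < b) : L2 × ℂ →L[ℂ] L2 × ℂ :=
  coreInclusion.extendOfNorm (baseGrushin b hb)

/-- `D²` composed with the inverse of the Grushin operator at the base point. -/
def baseDD (b : ℝ) (hb : 0 < b) : L2 × ℂ →L[ℂ] L2 := coreDD.extendOfNorm (baseGrushin b hb)

/-- `x D + D x` composed with the inverse of the Grushin operator at the base point. -/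
def baseXD (b : ℝ) (hb : 0 < b) : L2 × ℂ →L[ℂ] L2 := coreXD.extendOfNorm (baseGrushin b hb)

theorem baseInverse_baseGrushin {b : ℝ} (hb : 0 < b) (w : 𝓢(ℝ, ℂ) × ℂ) :
    baseInverse b hb (baseGrushin b hb w) = (toL2 w.1, w.2) :=
  LinearMap.extendOfNorm_eq (denseRange_baseGrushin hb) (coreInclusion_bound hb) w

theorem baseDD_baseGrushin {b : ℝ} (hb : 0 < b) (w : 𝓢(ℝ, ℂ) × ℂ) :
    baseDD b hb (baseGrushin b hb w) = toL2 (opD (opD w.1)) :=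
  LinearMap.extendOfNorm_eq (denseRange_baseGrushin hb) (coreDD_bound hb) w

theorem baseXD_baseGrushin {b : ℝ} (hb : 0 < b) (w : 𝓢(ℝ, ℂ) × ℂ) :
    baseXD b hb (baseGrushin b hb w) = toL2 (opX (opD w.1) + opD (opX w.1)) :=
  LinearMap.extendOfNorm_eq (denseRange_baseGrushin hb) (coreXD_bound hb) w

/-- The Grushin operator composed with its inverse at the base point, as a function of the
coefficients `(β² + α² - b², α, z)`. -/
def relGrushin (b : ℝ) (hb : 0 < b) (q : ℂ × ℂ × ℂ) : L2 × ℂ →L[ℂ] L2 × ℂ :=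
  1 + (q.1 • (ContinuousLinearMap.inl ℂ L2 ℂ ∘L baseDD b hb)
    - q.2.1 • (ContinuousLinearMap.inl ℂ L2 ℂ ∘L baseXD b hb)
    - q.2.2 • (ContinuousLinearMap.inl ℂ L2 ℂ ∘L ContinuousLinearMap.fst ℂ L2 ℂ ∘L
        baseInverse b hb))

theorem relGrushin_zero {b : ℝ} (hb : 0 < b) : relGrushin b hb 0 = 1 := by
  simp only [relGrushin, Prod.fst_zero, Prod.snd_zero]
  module

theorem contDiff_relGrushin {b : ℝ} (hb : 0 < b) : ContDiff ℂ ∞ (relGrushin b hb) := by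
  unfold relGrushin
  fun_prop

theorem relGrushin_sub {b : ℝ} (hb : 0 < b) (s α z z' : ℂ) :
    relGrushin b hb (s, α, z) - relGrushin b hb (s, α, z')
      = -(z - z') • (ContinuousLinearMap.inl ℂ L2 ℂ ∘L ContinuousLinearMap.fst ℂ L2 ℂ ∘L
        baseInverse b hb) := by
  simp only [relGrushin]
  module

/-- The coefficients of the perturbed Grushin problem. -/
def coeff (b α β : ℝ) (z : ℂ) : ℂ × ℂ × ℂ := (((β ^ 2 + α ^ 2 - b ^ 2 : ℝ) : ℂ), (α : ℂ), z)

/-- The factorization that reduces the unbounded perturbed problem to inverting a bounded operator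
near `1`. -/
theorem relGrushin_baseGrushin {b : ℝ} (hb : 0 < b) (α β : ℝ) (z : ℂ) (w : 𝓢(ℝ, ℂ) × ℂ) :
    relGrushin b hb (coeff b α β z) (baseGrushin b hb w)
      = (toL2 (oscSchwartz α β w.1) - ((b : ℂ) + z) • toL2 w.1 + w.2 • groundState b hb,
        ⟪groundState b hb, toL2 w.1⟫_ℂ) := by
  have h : relGrushin b hb (coeff b α β z) (baseGrushin b hb w)
      = baseGrushin b hb w + (((β ^ 2 + α ^ 2 - b ^ 2 : ℝ) : ℂ) •
          (baseDD b hb (baseGrushin b hb w), (0 : ℂ))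
        - (α : ℂ) • (baseXD b hb (baseGrushin b hb w), (0 : ℂ))
        - z • ((baseInverse b hb (baseGrushin b hb w)).1, (0 : ℂ))) := rfl
  rw [h, baseDD_baseGrushin, baseXD_baseGrushin, baseInverse_baseGrushin, baseGrushin_apply,
    oscSchwartz_eq_ladder α β b]
  refine Prod.ext ?_ ?_
  · simp only [Prod.fst_add, Prod.fst_sub, Prod.smul_fst, map_add, map_sub, map_smul]
    module
  · simp

/-- The inverse of the Grushin operator, as a function of the coefficients. -/
def grushinInverse (b : ℝ) (hb : 0 < b) (q : ℂ × ℂ × ℂ) : L2 × ℂ →L[ℂ] L2 × ℂ :=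
  baseInverse b hb ∘L Ring.inverse (relGrushin b hb q)

theorem contDiffAt_grushinInverse {b : ℝ} (hb : 0 < b) {q : ℂ × ℂ × ℂ}
    (hq : IsUnit (relGrushin b hb q)) : ContDiffAt ℂ ∞ (grushinInverse b hb) q := by
  obtain ⟨y, hy⟩ := hq
  have h : ContDiffAt ℂ ∞ (fun q => Ring.inverse (relGrushin b hb q)) q := by
    have h' : ContDiffAt ℂ ∞ Ring.inverse (relGrushin b hb q) := by
      rw [← hy]
      exact contDiffAt_ringInverse ℂ y
    exact h'.comp q (contDiff_relGrushin hb).contDiffAt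
  exact contDiffAt_const.clm_comp h

theorem relGrushin_inverse_apply {b : ℝ} (hb : 0 < b) {q : ℂ × ℂ × ℂ}
    (hq : IsUnit (relGrushin b hb q)) (v : L2 × ℂ) :
    relGrushin b hb q (Ring.inverse (relGrushin b hb q) v) = v :=
  DFunLike.congr_fun (Ring.mul_inverse_cancel _ hq) v

theorem grushinInverse_relGrushin {b : ℝ} (hb : 0 < b) {q : ℂ × ℂ × ℂ}
    (hq : IsUnit (relGrushin b hb q)) (v : L2 × ℂ) :
    grushinInverse b hb q (relGrushin b hb q v) = baseInverse b hb v :=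
  congrArg (baseInverse b hb) (DFunLike.congr_fun (Ring.inverse_mul_cancel _ hq) v)

/-- The value `baseInverse v` is in the domain of the perturbed Grushin operator, which maps it to
`relGrushin v`. -/
theorem baseInverse_mem_closure {b : ℝ} (hb : 0 < b) (α β : ℝ) (z : ℂ) (v : L2 × ℂ) :
    ((baseInverse b hb v).1, (relGrushin b hb (coeff b α β z) v).1
      + ((b : ℂ) + z) • (baseInverse b hb v).1 - (baseInverse b hb v).2 • groundState b hb)
        ∈ (oscCore α β).topologicalClosure
    ∧ ⟪groundState b hb, (baseInverse b hb v).1⟫_ℂ = (relGrushin b hb (coeff b α β z) v).2 := by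
  induction v using (denseRange_baseGrushin hb).induction_on with
  -- Both conditions are closed in `v`, the first because the graph is closed, so the dense range of
  -- `baseGrushin` suffices.
  | hp =>
    generalize relGrushin b hb (coeff b α β z) = R
    generalize baseInverse b hb = S
    refine IsClosed.inter ?_ (isClosed_eq (by fun_prop) (by fun_prop))
    exact (Submodule.isClosed_topologicalClosure _).preimage (by fun_prop)
  | ih w =>
    rw [relGrushin_baseGrushin, baseInverse_baseGrushin]
    refine ⟨Submodule.le_topologicalClosure _ ⟨w.1, ?_⟩, rfl⟩
    change (toL2 w.1, toL2 (oscSchwartz α β w.1)) = _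
    refine Prod.ext rfl ?_
    simp only
    abel

theorem grushinInverse_of_mem_closure {b : ℝ} (hb : 0 < b) {α β : ℝ} {z : ℂ}
    (hq : IsUnit (relGrushin b hb (coeff b α β z))) {x : L2 × L2}
    (hx : x ∈ (oscCore α β).topologicalClosure) (c : ℂ) :
    grushinInverse b hb (coeff b α β z) (x.2 - ((b : ℂ) + z) • x.1 + c • groundState b hb,
      ⟪groundState b hb, x.1⟫_ℂ) = (x.1, c) := by
  have hcl : IsClosed {x : L2 × L2 | grushinInverse b hb (coeff b α β z)
      (x.2 - ((b : ℂ) + z) • x.1 + c • groundState b hb, ⟪groundState b hb, x.1⟫_ℂ)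
        = (x.1, c)} := isClosed_eq (by fun_prop) (by fun_prop)
  refine closure_minimal ?_ hcl hx
  rintro _ ⟨f, rfl⟩
  have h := relGrushin_baseGrushin hb α β z (f, c)
  have h' := grushinInverse_relGrushin hb hq (baseGrushin b hb (f, c))
  rw [h, baseInverse_baseGrushin] at h'
  exact h'

/-- The right inverse comes from the closed graph containing the values of `baseInverse`, the left
inverse from density of the core in the graph. Self-adjointness is not needed. -/
theorem isInverse_grushinInverse (A : ℝ × ℝ → ℝ) {b : ℝ} (hb : 0 < b) (p : ℝ × ℝ) (z : ℂ)
    (hq : IsUnit (relGrushin b hb (coeff b (aHat A p) (bHat A p) z))) :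
    IsInverse (grushin A b hb p z)
      (grushinInverse b hb (coeff b (aHat A p) (bHat A p) z)) := by
  have hg := oscillator_graph (aHat A p) (bHat A p)
  constructor
  · intro v
    have h := baseInverse_mem_closure hb (aHat A p) (bHat A p) z
      (Ring.inverse (relGrushin b hb (coeff b (aHat A p) (bHat A p) z)) v)
    rw [relGrushin_inverse_apply hb hq] at h
    change ((grushinInverse b hb (coeff b (aHat A p) (bHat A p) z) v).1,
      v.1 + ((b : ℂ) + z) • (grushinInverse b hb (coeff b (aHat A p) (bHat A p) z) v).1
        - (grushinInverse b hb (coeff b (aHat A p) (bHat A p) z) v).2 • groundState b hb)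
        ∈ (oscCore (aHat A p) (bHat A p)).topologicalClosure
      ∧ ⟪groundState b hb, (grushinInverse b hb (coeff b (aHat A p) (bHat A p) z) v).1⟫_ℂ
        = v.2 at h
    obtain ⟨h1, h2⟩ := h
    rw [← hg] at h1
    obtain ⟨⟨y, hy⟩, e1, e2⟩ := (LinearPMap.mem_graph_iff _).1 h1
    set w := grushinInverse b hb (coeff b (aHat A p) (bHat A p) z) v with hw
    simp only at e1 e2
    subst e1
    refine ⟨⟨hy, trivial⟩, Prod.ext ?_ h2⟩
    change oscillator (aHat A p) (bHat A p) ⟨w.1, hy⟩ - ((b : ℂ) + z) • w.1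
      + w.2 • groundState b hb = v.1
    rw [e2]
    abel
  · rintro ⟨w, hw⟩
    have h1 := (oscillator (aHat A p) (bHat A p)).mem_graph ⟨w.1, hw.1⟩
    rw [hg] at h1
    exact grushinInverse_of_mem_closure hb hq h1 w.2

/-! ### The effective Hamiltonian -/

/-- The resolvent identity for the lower right entry. -/
theorem scalarEntry_grushinInverse_sub {b : ℝ} (hb : 0 < b) {s α z z' : ℂ}
    (h : IsUnit (relGrushin b hb (s, α, z))) (h' : IsUnit (relGrushin b hb (s, α, z'))) :
    scalarEntry (grushinInverse b hb (s, α, z)) - scalarEntry (grushinInverse b hb (s, α, z'))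
      = (z - z') * (grushinInverse b hb (s, α, z)
          ((grushinInverse b hb (s, α, z') (0, 1)).1, 0)).2 := by
  set y := Ring.inverse (relGrushin b hb (s, α, z')) ((0 : L2), (1 : ℂ)) with hy
  have h1 : relGrushin b hb (s, α, z') y = (0, 1) := relGrushin_inverse_apply hb h' _
  -- `baseInverse y` is computed in two ways, through `z` and through `z'`; `relGrushin` is affine
  -- in `z`, which gives the difference exactly.
  have h2 : grushinInverse b hb (s, α, z) (relGrushin b hb (s, α, z) y)
      = grushinInverse b hb (s, α, z') (0, 1) := grushinInverse_relGrushin hb h y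
  have h3 : relGrushin b hb (s, α, z) y
      = (0, 1) - (z - z') • ((grushinInverse b hb (s, α, z') (0, 1)).1, (0 : ℂ)) := by
    have := DFunLike.congr_fun (relGrushin_sub hb s α z z') y
    change relGrushin b hb (s, α, z) y - relGrushin b hb (s, α, z') y
      = -(z - z') • ((grushinInverse b hb (s, α, z') (0, 1)).1, (0 : ℂ)) at this
    rw [h1] at this
    rw [sub_eq_iff_eq_add.1 this]
    module
  rw [h3, map_sub, map_smul] at h2
  have h4 := congrArg Prod.snd h2
  simp only [Prod.snd_sub, Prod.smul_snd, smul_eq_mul] at h4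
  simp only [scalarEntry]
  linear_combination h4

/-- The lower right entry vanishes when `b + z` is the ground state energy. -/
theorem scalarEntry_grushinInverse_ground {b : ℝ} (hb : 0 < b) {α β : ℝ} (hβ : 0 < β)
    (h : IsUnit (relGrushin b hb (coeff b α β ((β - b : ℝ) : ℂ)))) :
    scalarEntry (grushinInverse b hb (coeff b α β ((β - b : ℝ) : ℂ))) = 0 := by
  set w : ℂ := β + α * Complex.I with hw
  have hwre : w.re = β := by simp [hw]
  have hw0 : w ≠ 0 := fun h0 => by rw [h0] at hwre; simp at hwre; linarith
  -- The width of the exact ground state; `Re c > 0` because `β > 0`.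
  set c : ℂ := (2 * w)⁻¹ with hc
  have hcre : 0 < c.re := by
    rw [hc, Complex.inv_re]
    refine div_pos ?_ (Complex.normSq_pos.2 (mul_ne_zero two_ne_zero hw0))
    simpa [hwre] using hβ
  have hcw : 2 * c * w = 1 := by rw [hc]; field_simp
  set g := gaussian c hcre with hg
  have hosc : oscSchwartz α β g = (β : ℂ) • g := oscSchwartz_gaussian hcre hcw
  set E := grushinInverse b hb (coeff b α β ((β - b : ℝ) : ℂ)) with hE
  have h1 : E (0, ⟪groundState b hb, toL2 g⟫_ℂ) = (toL2 g, 0) := by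
    have e := grushinInverse_relGrushin hb h (baseGrushin b hb (g, 0))
    rw [relGrushin_baseGrushin, baseInverse_baseGrushin, hosc] at e
    rw [← e]
    congr 1
    refine Prod.ext ?_ rfl
    simp only [map_smul]
    push_cast
    module
  have h2 : ((0 : L2), ⟪groundState b hb, toL2 g⟫_ℂ)
      = ⟪groundState b hb, toL2 g⟫_ℂ • ((0 : L2), (1 : ℂ)) := by simp
  rw [h2, map_smul] at h1
  have h3 := congrArg Prod.snd h1
  -- Either the scalar entry vanishes or the overlap `⟨h₀, g⟩` does; the latter would force `g = 0`
  -- through `h1`, so no estimate of the overlap is required.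
  rcases mul_eq_zero.1 h3 with h4 | h4
  · exfalso
    rw [h4, zero_smul] at h1
    have h5 : toL2 g = 0 := (congrArg Prod.fst h1).symm
    have h6 : g = 0 := SchwartzMap.injective_toLp 2 (volume : Measure ℝ) (h5.trans (map_zero toL2).symm)
    have h7 : g 0 = 0 := by rw [h6]; rfl
    rw [hg, gaussian_apply] at h7
    exact Complex.exp_ne_zero _ h7
  · exact h4

theorem grushinInverse_zero_ground {b : ℝ} (hb : 0 < b) :
    grushinInverse b hb 0 (groundState b hb, 0) = (0, 1)
      ∧ grushinInverse b hb 0 (0, 1) = (groundState b hb, 0) := by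
  have hE : grushinInverse b hb 0 = baseInverse b hb := by
    rw [grushinInverse, relGrushin_zero, Ring.inverse_one]; rfl
  have h1 := baseInverse_baseGrushin hb (0, 1)
  have h2 := baseInverse_baseGrushin hb (vacuum b hb, 0)
  rw [baseGrushin_apply] at h1 h2
  rw [hE]
  have hv := (isLadder hb).inner_vac_vac
  rw [toL2_vacuum] at hv
  constructor
  · simpa using h1
  · simpa [(isLadder hb).vac, toL2_vacuum, hv, norm_groundState] using h2

/-! ### The change of variables -/

open Filter Topology

theorem hasDerivAt_comp_smul {E F : Type*} [NormedAddCommGroup E] [NormedSpace ℝ E]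
    [NormedAddCommGroup F] [NormedSpace ℝ F] {g : E → F} (hg : Differentiable ℝ g) (v : E) (t : ℝ) :
    HasDerivAt (fun s : ℝ => g (s • v)) (fderiv ℝ g (t • v) v) t := by
  have hline : HasDerivAt (fun s : ℝ => s • v) v t := by
    simpa using! (hasDerivAt_id t).smul_const v
  exact HasFDerivAt.comp_hasDerivAt (f := fun s : ℝ => s • v) t (hg (t • v)).hasFDerivAt hline

namespace IsAdmissible

variable {A : ℝ × ℝ → ℝ} {b₀ : ℝ}

theorem contDiff_magField (hA : IsAdmissible A b₀) : ContDiff ℝ ∞ (magField A) :=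
  (hA.smooth.fderiv_right (m := ∞) le_rfl).clm_apply contDiff_const

theorem contDiff_potY (hA : IsAdmissible A b₀) : ContDiff ℝ ∞ (potY A) :=
  (hA.smooth.fderiv_right (m := ∞) le_rfl).clm_apply contDiff_const

theorem contDiff_phi (hA : IsAdmissible A b₀) : ContDiff ℝ ∞ (phi A) :=
  hA.smooth.prodMk contDiff_snd

/-- The sign is forced by the Hessian. If the value were `-b₀`, then `|b| ≥ b₀` would make the
origin a local maximum of `b`, while positive second derivative makes it a local minimum along a
line. Then `b` would be constant near `0` on that line, against uniqueness of the minimum of `|b|`.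
-/
theorem magField_zero (hA : IsAdmissible A b₀) : magField A 0 = b₀ := by
  refine ((abs_eq hA.pos.le).1 ((hA.abs_eq_iff 0).2 rfl)).resolve_right fun hneg => ?_
  set v : ℝ × ℝ := (1, 0) with hv
  have hv0 : v ≠ 0 := by simp [hv]
  have hb := hA.contDiff_magField
  set f : ℝ → ℝ := fun t => magField A (t • v) with hf
  have hf' : ∀ t, HasDerivAt f (fderiv ℝ (magField A) (t • v) v) t := fun t =>
    hasDerivAt_comp_smul (hb.differentiable (by simp)) v t
  have hfderiv : deriv f = fun t => fderiv ℝ (magField A) (t • v) v :=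
    funext fun t => (hf' t).deriv
  have hf'' : deriv (deriv f) 0 = fderiv ℝ (fderiv ℝ (magField A)) 0 v v := by
    rw [hfderiv]
    have h1 := (hasDerivAt_comp_smul ((hb.fderiv_right (m := ∞) le_rfl).differentiable (by simp))
      v 0).clm_apply (hasDerivAt_const (0 : ℝ) v)
    rw [h1.deriv, map_zero, add_zero, zero_smul]
  have hcont : Continuous f := continuous_iff_continuousAt.2 fun t => (hf' t).continuousAt
  have hf0 : f 0 = -b₀ := by simp [hf, hneg]
  have hlt : ∀ᶠ t in 𝓝 (0 : ℝ), f t < 0 :=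
    hcont.continuousAt.eventually_lt continuousAt_const (by rw [hf0]; linarith [hA.pos])
  have hle : ∀ᶠ t in 𝓝 (0 : ℝ), f t ≤ f 0 := by
    filter_upwards [hlt] with t ht
    have h1 : b₀ ≤ |f t| := hA.le_abs (t • v)
    rw [abs_of_neg ht] at h1
    rw [hf0]; linarith
  have hmax : IsLocalMax f 0 := hle
  have hmin : IsLocalMin f 0 := isLocalMin_of_deriv_deriv_pos
    (by rw [hf'']; exact hA.hess_pos v hv0) hmax.deriv_eq_zero hcont.continuousAt
  have hconst : ∀ᶠ t in 𝓝 (0 : ℝ), f t = -b₀ := by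
    filter_upwards [hle, hmin] with t h1 h2
    rw [← hf0]; exact le_antisymm h1 h2
  obtain ⟨t, ht, ht0⟩ : ∃ t : ℝ, f t = -b₀ ∧ t ∈ ({0}ᶜ : Set ℝ) :=
    ((hconst.filter_mono nhdsWithin_le_nhds).and (self_mem_nhdsWithin (s := {0}ᶜ))).exists
  have h1 : |magField A (t • v)| = b₀ := by
    change |f t| = b₀
    rw [ht, abs_neg, abs_of_pos hA.pos]
  exact ht0 ((smul_eq_zero.1 ((hA.abs_eq_iff _).1 h1)).resolve_right hv0)

theorem magField_pos (hA : IsAdmissible A b₀) (p : ℝ × ℝ) : 0 < magField A p := by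
  by_contra! h
  obtain ⟨q, hq⟩ := mem_range_of_exists_le_of_exists_ge hA.contDiff_magField.continuous
    ⟨p, h⟩ ⟨0, by rw [hA.magField_zero]; exact hA.pos.le⟩
  have := hA.le_abs q
  rw [hq, abs_zero] at this
  linarith [hA.pos]

theorem phi_injective (hA : IsAdmissible A b₀) : Function.Injective (phi A) := by
  rintro ⟨x, y⟩ ⟨x', y'⟩ h
  obtain ⟨h1, rfl⟩ : A (x, y) = A (x', y') ∧ y = y' := by simpa [phi] using h
  have hmono : StrictMono fun s : ℝ => A (s, y) := by
    refine strictMono_of_deriv_pos fun s => ?_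
    have hs : HasDerivAt (fun s : ℝ => (s, y)) ((1 : ℝ), (0 : ℝ)) s :=
      (hasDerivAt_id s).prodMk (hasDerivAt_const s y)
    have := ((hA.smooth.differentiable (by simp)) (s, y)).hasFDerivAt.comp_hasDerivAt s hs
    have h2 : deriv (fun s : ℝ => A (s, y)) s = magField A (s, y) := this.deriv
    rw [h2]
    exact hA.magField_pos _
  rw [hmono.injective h1]

theorem exists_hasFDerivAt_phi (hA : IsAdmissible A b₀) (p : ℝ × ℝ) :
    ∃ e : (ℝ × ℝ) ≃L[ℝ] ℝ × ℝ, HasFDerivAt (phi A) (e : ℝ × ℝ →L[ℝ] ℝ × ℝ) p := by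
  set T : ℝ × ℝ →L[ℝ] ℝ × ℝ := (fderiv ℝ A p).prod (ContinuousLinearMap.snd ℝ ℝ ℝ) with hT
  have hd : HasFDerivAt (phi A) T p :=
    ((hA.smooth.differentiable (by simp)) p).hasFDerivAt.prodMk hasFDerivAt_snd
  have hinj : Function.Injective T.toLinearMap := by
    rw [← LinearMap.ker_eq_bot, LinearMap.ker_eq_bot']
    rintro ⟨x, y⟩ h
    obtain ⟨h1, rfl⟩ : fderiv ℝ A p (x, y) = 0 ∧ y = 0 := by simpa [hT] using h
    have h2 : fderiv ℝ A p (x, 0) = x * magField A p := by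
      rw [magField, ← smul_eq_mul, ← map_smul]; simp
    rw [h2] at h1
    simpa using (mul_eq_zero.1 h1).resolve_right (hA.magField_pos p).ne'
  refine ⟨(LinearEquiv.ofInjectiveEndo T.toLinearMap hinj).toContinuousLinearEquiv, ?_⟩
  convert hd using 1
  ext1 <;> rfl

/-- By injectivity the global inverse coincides near `phi A p` with the local inverse of the inverse
function theorem. -/
theorem contDiffAt_invFun_phi (hA : IsAdmissible A b₀) (p : ℝ × ℝ) :
    ContDiffAt ℝ ∞ (Function.invFun (phi A)) (phi A p) := by
  obtain ⟨e, he⟩ := hA.exists_hasFDerivAt_phi p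
  have hp : ContDiffAt ℝ ∞ (phi A) p := hA.contDiff_phi.contDiffAt
  refine (hp.to_localInverse he (by simp)).congr_of_eventuallyEq ?_
  filter_upwards [(hp.hasStrictFDerivAt' he (by simp)).eventually_right_inverse] with q hq
  conv_lhs => rw [← hq]
  exact Function.leftInverse_invFun hA.phi_injective _

theorem isOpen_range_phi (hA : IsAdmissible A b₀) : IsOpen (Set.range (phi A)) := by
  choose e he using hA.exists_hasFDerivAt_phi
  exact (isOpenMap_of_hasStrictFDerivAt_equiv fun p =>
    hA.contDiff_phi.contDiffAt.hasStrictFDerivAt' (he p) (by simp)).isOpen_range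

theorem phi_zero (hA : IsAdmissible A b₀) : phi A 0 = 0 := by
  simp [phi, hA.pot_zero]

theorem invFun_phi_zero (hA : IsAdmissible A b₀) : Function.invFun (phi A) 0 = 0 := by
  conv_lhs => rw [← hA.phi_zero]
  exact Function.leftInverse_invFun hA.phi_injective _

theorem bHat_zero (hA : IsAdmissible A b₀) : bHat A 0 = b₀ := by
  rw [bHat, hA.invFun_phi_zero, hA.magField_zero]

theorem aHat_zero (hA : IsAdmissible A b₀) : aHat A 0 = 0 := by
  rw [aHat, hA.invFun_phi_zero, hA.potY_zero]

/-- Holds even off the range of `phi A`, since `Function.invFun` always returns some point of the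
plane. -/
theorem bHat_pos (hA : IsAdmissible A b₀) (p : ℝ × ℝ) : 0 < bHat A p := hA.magField_pos _

theorem contDiffAt_bHat (hA : IsAdmissible A b₀) {p : ℝ × ℝ} (hp : p ∈ Set.range (phi A)) :
    ContDiffAt ℝ ∞ (bHat A) p := by
  obtain ⟨q, rfl⟩ := hp
  exact hA.contDiff_magField.contDiffAt.comp _ (hA.contDiffAt_invFun_phi q)

theorem contDiffAt_aHat (hA : IsAdmissible A b₀) {p : ℝ × ℝ} (hp : p ∈ Set.range (phi A)) :
    ContDiffAt ℝ ∞ (aHat A) p := by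
  obtain ⟨q, rfl⟩ := hp
  exact hA.contDiff_potY.contDiffAt.comp _ (hA.contDiffAt_invFun_phi q)

end IsAdmissible

/-! ### The elliptic factor -/

/-- The product `ε₋(q) ε₊(q')` of off-diagonal entries of the inverses of two Grushin operators. -/
def offDiagProd (b : ℝ) (hb : 0 < b) (r : (ℂ × ℂ × ℂ) × (ℂ × ℂ × ℂ)) : ℂ :=
  (grushinInverse b hb r.1 ((grushinInverse b hb r.2 (0, 1)).1, 0)).2

theorem contDiffAt_offDiagProd {b : ℝ} (hb : 0 < b) {r : (ℂ × ℂ × ℂ) × (ℂ × ℂ × ℂ)}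
    (h1 : IsUnit (relGrushin b hb r.1)) (h2 : IsUnit (relGrushin b hb r.2)) :
    ContDiffAt ℂ ∞ (offDiagProd b hb) r := by
  have e1 : ContDiffAt ℂ ∞ (fun r : (ℂ × ℂ × ℂ) × (ℂ × ℂ × ℂ) => grushinInverse b hb r.1) r :=
    (contDiffAt_grushinInverse hb h1).comp r contDiffAt_fst
  have e2 : ContDiffAt ℂ ∞ (fun r : (ℂ × ℂ × ℂ) × (ℂ × ℂ × ℂ) => grushinInverse b hb r.2) r :=
    (contDiffAt_grushinInverse hb h2).comp r contDiffAt_snd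
  exact (e1.clm_apply ((e2.clm_apply contDiffAt_const).fst.prodMk contDiffAt_const)).snd

theorem offDiagProd_zero {b : ℝ} (hb : 0 < b) : offDiagProd b hb (0, 0) = 1 := by
  simp only [offDiagProd, (grushinInverse_zero_ground hb).2, (grushinInverse_zero_ground hb).1]

theorem isOpen_isUnit_relGrushin {b : ℝ} (hb : 0 < b) :
    IsOpen {q | IsUnit (relGrushin b hb q)} :=
  Units.isOpen.preimage (contDiff_relGrushin hb).continuous

/-- The coefficients of the Grushin problem at `(p, z)` and at `(p, b̂(p) - b₀)`. -/
def coeffPair (A : ℝ × ℝ → ℝ) (b₀ : ℝ) (x : (ℝ × ℝ) × ℂ) : (ℂ × ℂ × ℂ) × (ℂ × ℂ × ℂ) :=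
  (coeff b₀ (aHat A x.1) (bHat A x.1) x.2,
    coeff b₀ (aHat A x.1) (bHat A x.1) ((bHat A x.1 - b₀ : ℝ) : ℂ))

theorem contDiffAt_coeffPair {A : ℝ × ℝ → ℝ} {b₀ : ℝ} (hA : IsAdmissible A b₀)
    {x : (ℝ × ℝ) × ℂ} (hx : x.1 ∈ Set.range (phi A)) : ContDiffAt ℝ ∞ (coeffPair A b₀) x := by
  have ha : ContDiffAt ℝ ∞ (fun x : (ℝ × ℝ) × ℂ => aHat A x.1) x :=
    (hA.contDiffAt_aHat hx).comp x contDiffAt_fst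
  have hb : ContDiffAt ℝ ∞ (fun x : (ℝ × ℝ) × ℂ => bHat A x.1) x :=
    (hA.contDiffAt_bHat hx).comp x contDiffAt_fst
  have hofReal : ∀ {f : (ℝ × ℝ) × ℂ → ℝ}, ContDiffAt ℝ ∞ f x →
      ContDiffAt ℝ ∞ (fun x => (f x : ℂ)) x := fun hf =>
    Complex.ofRealCLM.contDiff.contDiffAt.comp x hf
  have hs := hofReal (((hb.pow 2).add (ha.pow 2)).sub (contDiffAt_const (c := b₀ ^ 2)))
  exact (hs.prodMk ((hofReal ha).prodMk contDiffAt_snd)).prodMk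
    (hs.prodMk ((hofReal ha).prodMk (hofReal (hb.sub contDiffAt_const))))

theorem coeffPair_zero {A : ℝ × ℝ → ℝ} {b₀ : ℝ} (hA : IsAdmissible A b₀) :
    coeffPair A b₀ (0, 0) = (0, 0) := by
  simp [coeffPair, coeff, hA.aHat_zero, hA.bHat_zero]

end MagneticGrushin

end

/-! ### Invertibility and factorization near the origin -/

open MagneticGrushin in
theorem proposition5p3 (A : ℝ × ℝ → ℝ) (b₀ : ℝ) (hA : IsAdmissible A b₀) :
    ∃ (Ω : Set (ℝ × ℝ)) (α₀ : ℝ) (E : ℝ × ℝ → ℂ → ((L2 × ℂ) →L[ℂ] (L2 × ℂ)))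
      (q₀ : (ℝ × ℝ) × ℂ → ℂ),
      IsOpen Ω ∧ (0 : ℝ × ℝ) ∈ Ω ∧ 0 < α₀ ∧
      (∀ p ∈ Ω, ∀ z : ℂ, ‖z‖ < α₀ → IsInverse (grushin A b₀ hA.pos p z) (E p z)) ∧
      ContDiffOn ℝ ∞ q₀ (Ω ×ˢ Metric.ball (0 : ℂ) α₀) ∧
      (∃ c : ℝ, 0 < c ∧ ∀ p ∈ Ω, ∀ z : ℂ, ‖z‖ < α₀ → c ≤ ‖q₀ (p, z)‖) ∧
      (∀ p ∈ Ω, ∀ z : ℂ, ‖z‖ < α₀ →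
        scalarEntry (E p z) = -(q₀ (p, z) * (((bHat A p - b₀ : ℝ) : ℂ) - z))) ∧
      q₀ (0, 0) = 1 := by
  have hb := hA.pos
  have h0 : (0 : ℝ × ℝ) ∈ Set.range (phi A) := ⟨0, hA.phi_zero⟩
  have hsmooth : ∀ x : (ℝ × ℝ) × ℂ, x.1 ∈ Set.range (phi A) →
      IsUnit (relGrushin b₀ hb (coeffPair A b₀ x).1) →
      IsUnit (relGrushin b₀ hb (coeffPair A b₀ x).2) →
      ContDiffAt ℝ ∞ (fun x => offDiagProd b₀ hb (coeffPair A b₀ x)) x := fun x hx h1 h2 =>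
    ((contDiffAt_offDiagProd hb h1 h2).restrict_scalars ℝ).comp x (contDiffAt_coeffPair hA hx)
  have hunit : IsUnit (relGrushin b₀ hb 0) := by rw [relGrushin_zero]; exact isUnit_one
  have hc := (contDiffAt_coeffPair hA (x := (0, 0)) h0).continuousAt
  have ev1 : ∀ᶠ x in nhds ((0 : ℝ × ℝ), (0 : ℂ)),
      IsUnit (relGrushin b₀ hb (coeffPair A b₀ x).1) :=
    (continuousAt_fst.comp hc).eventually_mem ((isOpen_isUnit_relGrushin hb).mem_nhds (by
      simpa [coeffPair_zero hA] using hunit))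
  have ev2 : ∀ᶠ x in nhds ((0 : ℝ × ℝ), (0 : ℂ)),
      IsUnit (relGrushin b₀ hb (coeffPair A b₀ x).2) :=
    (continuousAt_snd.comp hc).eventually_mem ((isOpen_isUnit_relGrushin hb).mem_nhds (by
      simpa [coeffPair_zero hA] using hunit))
  have hq0 : offDiagProd b₀ hb (coeffPair A b₀ (0, 0)) = 1 := by
    rw [coeffPair_zero hA, offDiagProd_zero]
  -- Ellipticity: `q₀` is continuous and equals `1` at the origin, so `1/2` is a lower bound nearby.
  have ev3 : ∀ᶠ x in nhds ((0 : ℝ × ℝ), (0 : ℂ)),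
      1 / 2 < ‖offDiagProd b₀ hb (coeffPair A b₀ x)‖ := by
    refine continuousAt_const.eventually_lt
      (hsmooth (0, 0) h0 ev1.self_of_nhds ev2.self_of_nhds).continuousAt.norm ?_
    rw [hq0]; norm_num
  obtain ⟨U, hU, V, hV, hUV⟩ := mem_nhds_prod_iff.1 ((ev1.and ev2).and ev3)
  obtain ⟨W, hWU, hWo, h0W⟩ := mem_nhds_iff.1 hU
  obtain ⟨α₀, hα₀, hball⟩ := Metric.mem_nhds_iff.1 hV
  have key : ∀ p ∈ W ∩ Set.range (phi A), ∀ z : ℂ, ‖z‖ < α₀ →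
      (IsUnit (relGrushin b₀ hb (coeffPair A b₀ (p, z)).1)
        ∧ IsUnit (relGrushin b₀ hb (coeffPair A b₀ (p, z)).2))
        ∧ 1 / 2 < ‖offDiagProd b₀ hb (coeffPair A b₀ (p, z))‖ := fun p hp z hz =>
    hUV ⟨hWU hp.1, hball (by simpa using hz)⟩
  -- Intersecting with the open range of `phi A` keeps `b̂` and `Â_y` smooth on `Ω`; surjectivity of
  -- `φ` is not needed.
  refine ⟨W ∩ Set.range (phi A), α₀,
    fun p z => grushinInverse b₀ hb (coeff b₀ (aHat A p) (bHat A p) z),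
    fun x => offDiagProd b₀ hb (coeffPair A b₀ x), hWo.inter hA.isOpen_range_phi, ⟨h0W, h0⟩, hα₀,
    fun p hp z hz => isInverse_grushinInverse A hb p z (key p hp z hz).1.1, ?_,
    ⟨1 / 2, by norm_num, fun p hp z hz => (key p hp z hz).2.le⟩, fun p hp z hz => ?_, hq0⟩
  · rintro ⟨p, z⟩ ⟨hp, hz⟩
    have h := key p hp z (by simpa using hz)
    exact (hsmooth (p, z) hp.2 h.1.1 h.1.2).contDiffWithinAt
  · have h := key p hp z hz
    -- The resolvent identity is based at `z' = b̂ - b₀`, the zero of the scalar entry.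
    have h1 := scalarEntry_grushinInverse_sub hb (s := ((bHat A p ^ 2 + aHat A p ^ 2 - b₀ ^ 2 : ℝ) : ℂ))
      (α := (aHat A p : ℂ)) (z := z) (z' := ((bHat A p - b₀ : ℝ) : ℂ)) h.1.1 h.1.2
    have h2 := scalarEntry_grushinInverse_ground hb (hA.bHat_pos p) h.1.2
    change scalarEntry (grushinInverse b₀ hb (coeff b₀ (aHat A p) (bHat A p) z))
      - scalarEntry (grushinInverse b₀ hb
          (coeff b₀ (aHat A p) (bHat A p) ((bHat A p - b₀ : ℝ) : ℂ)))
      = (z - ((bHat A p - b₀ : ℝ) : ℂ)) * offDiagProd b₀ hb (coeffPair A b₀ (p, z)) at h1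
    rw [h2, sub_zero] at h1
    simp only
    rw [h1]
    ring
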